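/- Consider a transmitter $S$ that sends a message to a destination through two relays. In each channel use the relays receive $Y_1=X+J+N_1$ and $Y_2=-X+J+N_2$, respectively, where $X$ is the channel input and $J,N_1,N_2$ are independent memoryless zero-mean Gaussian processes of variances $P_J,1,1$. Relay $i$ observes only $Y_i$ and forwards $C_i$ bits per channel use over a noiseless link to the destination ("Case C"). A code of length $n$ and rate $R$ has $\lfloor 2^{nR}\rfloor$ equiprobable messages, average power $\frac1n\sum_{k=1}^n \mathrm E[X_k^2]\le P_X$, deterministic encoder and decoder, and (measurable) relay maps into sets of $\lfloor 2^{nC_1}\rfloor$ and $\lfloor 2^{nC_2}\rfloor$ elements; $R$ is achievable if for every $\varepsilon>0$ and all sufficiently large $n$ there is such a code with average error probability at most $\varepsilon$. The cut-set bound is $$R_{\rm cut}=\sup_{P_X\text{-admissible }X}\min\{C_1+C_2,\;C_1+I(X;Y_2),\;C_2+I(X;Y_1),\;I(X;Y_1,Y_2)\},$$ the supremum being over all input laws with $\mathrm E[X^2]\le P_X$ and $I$ being measured in bits, and the modulo bound is $$R_{\rm mod}=\tfrac12\Big(C_1+C_2+\tfrac12\log_2\big(1+\tfrac{P_X}{P_J}\big)\Big)+\tfrac14\log_2(8\pi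 e).$$ **Corollary (the cut-set upper bound is strictly loose for Case C).** Take $P_J=\sqrt{P_X}$ and $C_1=C_2=\frac14\log_2 P_X$. Then: 1. for every $P_X>1$, $R_{\rm cut}$ is finite, and $\lim_{P_X\to\infty} R_{\rm cut}/\log_2 P_X=\frac12$; 2. for every $P_X>1$, every achievable rate $R$ satisfies $R\le R_{\rm mod}$, and $\lim_{P_X\to\infty} R_{\rm mod}/\log_2 P_X=\frac38$; 3. consequently the cut-set bound is strictly loose: there is $\varepsilon>0$ such that for all sufficiently large $P_X$ one has $R_{\rm mod}+\varepsilon\log_2P_X\le R_{\rm cut}$ and every achievable rate $R$ satisfies $R+\varepsilon\log_2 P_X\le R_{\rm cut}$. -/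

import Mathlib

open MeasureTheory ProbabilityTheory Filter Topology
open scoped NNReal ENNReal

noncomputable section

namespace RelayChannel

/-- One transmitter, two relays: `Y₁ = a X + J + N₁`, `Y₂ = b X + J + N₂`, with input power `PX`,
interference power `PJ`, noise powers `PN1`, `PN2`, and lossless relay-to-destination links of
`C1`, `C2` bits per channel use. -/
structure Network where
  a : ℝ
  b : ℝ
  PX : ℝ≥0
  PJ : ℝ≥0
  PN1 : ℝ≥0
  PN2 : ℝ≥0
  C1 : ℝ
  C2 : ℝ

/-- Relaying two interfered signals in anti-phase, with unit noise powers. -/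
def caseC (PX PJ : ℝ≥0) (C1 C2 : ℝ) : Network where
  a := 1
  b := -1
  PX := PX
  PJ := PJ
  PN1 := 1
  PN2 := 1
  C1 := C1
  C2 := C2

/-- The index set `I_r = {1, …, 2^r}` has `⌊2^r⌋` elements. -/
def numIndices (r : ℝ) : ℕ := ⌊(2 : ℝ) ^ r⌋₊

namespace Network

variable (N : Network)

/-- Joint law of `(J, N₁, N₂)` in one channel use: independent centred Gaussians. -/
def noise : Measure (ℝ × ℝ × ℝ) :=
  (gaussianReal 0 N.PJ).prod ((gaussianReal 0 N.PN1).prod (gaussianReal 0 N.PN2))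

/-- First output, from the input `x` and `z = (j, n₁, n₂)`. -/
def out1 (x : ℝ) (z : ℝ × ℝ × ℝ) : ℝ := N.a * x + z.1 + z.2.1

/-- Second output, from the input `x` and `z = (j, n₁, n₂)`. -/
def out2 (x : ℝ) (z : ℝ × ℝ × ℝ) : ℝ := N.b * x + z.1 + z.2.2

/-- Law of the memoryless noise over `n` channel uses. -/
def noiseN (n : ℕ) : Measure (Fin n → ℝ × ℝ × ℝ) := Measure.pi fun _ => N.noise

/-- A block code of length `n` and rate `R`: encoder, two relay maps, decoder. The average power
constraint is over the uniformly distributed message and the `n` channel uses. -/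
structure Code (n : ℕ) (R : ℝ) where
  enc : Fin (numIndices (n * R)) → Fin n → ℝ
  relay1 : (Fin n → ℝ) → Fin (numIndices (n * N.C1))
  relay2 : (Fin n → ℝ) → Fin (numIndices (n * N.C2))
  dec : Fin (numIndices (n * N.C1)) × Fin (numIndices (n * N.C2)) → Fin (numIndices (n * R))
  measurable_relay1 : Measurable relay1
  measurable_relay2 : Measurable relay2
  power : (∑ w, ∑ k, enc w k ^ 2) / (numIndices (n * R) : ℝ) ≤ n * N.PX

variable {N} in
/-- The average probability `Pr{Ŵ ≠ W}`, for a uniformly distributed message `W`. -/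
def Code.errorProb {n : ℕ} {R : ℝ} (c : N.Code n R) : ℝ :=
  (∑ w, (N.noiseN n).real {z |
      c.dec (c.relay1 fun k => N.out1 (c.enc w k) (z k),
        c.relay2 fun k => N.out2 (c.enc w k) (z k)) ≠ w}) / (numIndices (n * R) : ℝ)

/-- `R` is achievable: the average error probability can be made arbitrarily small for all
sufficiently large block lengths. -/
def Achievable (R : ℝ) : Prop :=
  ∀ ε : ℝ, 0 < ε → ∃ n₀ : ℕ, ∀ n ≥ n₀, ∃ c : N.Code n R, c.errorProb ≤ ε

end Network

/-- Mutual information, in bits, of the two components of a pair with joint law `ρ`. -/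
def mutualInfo {α β : Type*} [MeasurableSpace α] [MeasurableSpace β] (ρ : Measure (α × β)) :
    ℝ≥0∞ :=
  InformationTheory.klDiv ρ (ρ.fst.prod ρ.snd) / ENNReal.ofReal (Real.log 2)

namespace Network

variable (N : Network)

/-- `I(X; Y₁)` for an input `X` with law `μ`. -/
def info1 (μ : Measure ℝ) : ℝ≥0∞ :=
  mutualInfo ((μ.prod N.noise).map fun p => (p.1, N.out1 p.1 p.2))

/-- `I(X; Y₂)` for an input `X` with law `μ`. -/
def info2 (μ : Measure ℝ) : ℝ≥0∞ :=
  mutualInfo ((μ.prod N.noise).map fun p => (p.1, N.out2 p.1 p.2))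

/-- `I(X; Y₁, Y₂)` for an input `X` with law `μ`. -/
def info12 (μ : Measure ℝ) : ℝ≥0∞ :=
  mutualInfo ((μ.prod N.noise).map fun p => (p.1, (N.out1 p.1 p.2, N.out2 p.1 p.2)))

/-- The cut-set bound: the supremum, over all input laws of power at most `PX`, of
`min {C₁ + C₂, C₁ + I(X; Y₂), C₂ + I(X; Y₁), I(X; Y₁, Y₂)}`. -/
def cutSetBound : ℝ≥0∞ :=
  ⨆ (μ : Measure ℝ) (_ : IsProbabilityMeasure μ)
    (_ : ∫⁻ x, ENNReal.ofReal (x ^ 2) ∂μ ≤ N.PX),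
    min (min (ENNReal.ofReal N.C1 + ENNReal.ofReal N.C2) (ENNReal.ofReal N.C1 + N.info2 μ))
      (min (ENNReal.ofReal N.C2 + N.info1 μ) (N.info12 μ))

/-- The modulo bound
`½ (C₁ + C₂ + ½ log₂ (1 + PX / PJ)) + ¼ log₂ (8 π e)`. -/
def moduloBound : ℝ :=
  (N.C1 + N.C2 + Real.logb 2 (1 + (N.PX : ℝ) / N.PJ) / 2) / 2
    + Real.logb 2 (8 * Real.pi * Real.exp 1) / 4

end Network

/-- The network of Case C with `PJ = √P` and `C₁ = C₂ = ¼ log₂ P`. -/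
def looseExample (P : ℝ≥0) : Network :=
  caseC P (NNReal.sqrt P) (Real.logb 2 P / 4) (Real.logb 2 P / 4)

end RelayChannel

end

/-!
Upper bound on rates. Let `I` be the mutual information of the message `W` and the pair `(A, B)` of
relay indices, so that `I + H(A, B | W) = H(A, B)` is at most the total capacity of the links. The
point is that `I` is also at most `H(A, B | W)` plus two costs, which bounds `2 I` by the capacity
of the links and these costs. To see this, compare the law of `(A, B)` given `W` with a mixture of
product laws: perturb the codeword `X` by Gaussian noise of variance `PJ` per letter to obtain `T`,
and let the relays act independently on the outputs which the input `T` would give. The information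
about `W` in `T` is at most `log (1 + PX / PJ) / 2` per letter, and the divergence between the true
output `a X + J + N` and the one with input `T` is bounded per letter, because the perturbation is
of the size of the interference `J`. What remains of the divergence of `(A, B)` from a product law
is the dependence of `A` and `B` given `W`, which is at most `H(A, B | W)`.

Lower bound on the cut-set bound. For a uniform input on `[-√PX, √PX]`, the difference `Y₁ - Y₂` is
free of the interference and locates `X` up to an error of order `1`, while a single output locates
it up to an error of order `√PJ`. A test of the event `|estimate - X| ≤ r` converts this into a
lower bound on the mutual information.
-/

noncomputable section

namespace RelayChannel

open InformationTheory

section Divergence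

variable {α β : Type*} [MeasurableSpace α] [MeasurableSpace β]

theorem klDiv_map_measurableEquiv (e : α ≃ᵐ β) (μ ν : Measure α) [IsFiniteMeasure μ]
    [IsFiniteMeasure ν] : klDiv (μ.map e) (ν.map e) = klDiv μ ν := by
  refine le_antisymm (klDiv_map_le μ ν e.measurable) ?_
  simpa only [MeasurableEquiv.map_symm_map] using
    klDiv_map_le (μ.map e) (ν.map e) e.symm.measurable

theorem klDiv_prod (μ₁ ν₁ : Measure α) (μ₂ ν₂ : Measure β) [IsProbabilityMeasure μ₁]
    [IsProbabilityMeasure ν₁] [IsProbabilityMeasure μ₂] [IsProbabilityMeasure ν₂] :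
    klDiv (μ₁.prod μ₂) (ν₁.prod ν₂) = klDiv μ₁ ν₁ + klDiv μ₂ ν₂ := by
  have swap (ν : Measure β) [IsProbabilityMeasure ν] :
      (μ₁.prod ν).map MeasurableEquiv.prodComm = ν.prod μ₁ := Measure.prod_swap
  have right : klDiv (μ₁.prod μ₂) (μ₁.prod ν₂) = klDiv μ₂ ν₂ := by
    rw [← klDiv_map_measurableEquiv MeasurableEquiv.prodComm, swap, swap,
      ← Measure.compProd_const, ← Measure.compProd_const, klDiv_compProd_left]
  rw [← right]
  simp only [← Measure.compProd_const]
  exact klDiv_compProd_eq_add μ₁ ν₁ (Kernel.const α μ₂) (Kernel.const α ν₂)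

theorem klDiv_pi {n : ℕ} {X : Fin n → Type*} [∀ i, MeasurableSpace (X i)]
    (μ ν : ∀ i, Measure (X i)) [∀ i, IsProbabilityMeasure (μ i)]
    [∀ i, IsProbabilityMeasure (ν i)] :
    klDiv (Measure.pi μ) (Measure.pi ν) = ∑ i, klDiv (μ i) (ν i) := by
  induction n with
  | zero => rw [Measure.pi_of_empty μ, Measure.pi_of_empty ν, klDiv_self, Fin.sum_univ_zero]
  | succ n ih =>
    rw [← klDiv_map_measurableEquiv (MeasurableEquiv.piFinSuccAbove X 0),
      (measurePreserving_piFinSuccAbove μ 0).map_eq, (measurePreserving_piFinSuccAbove ν 0).map_eq,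
      klDiv_prod, ih, Fin.sum_univ_succAbove _ 0]

theorem compProd_eq_withDensity_rnDeriv [MeasurableSpace.CountableOrCountablyGenerated α β]
    {μ : Measure α} [SFinite μ] {κ η : Kernel α β} [IsFiniteKernel κ] [IsFiniteKernel η]
    (h : ∀ᵐ a ∂μ, κ a ≪ η a) :
    μ ⊗ₘ κ = (μ ⊗ₘ η).withDensity fun p => κ.rnDeriv η p.1 p.2 := by
  have density := κ.measurable_rnDeriv η
  ext s hs
  rw [withDensity_apply _ hs, Measure.compProd_apply hs, ← lintegral_indicator hs,
    Measure.lintegral_compProd (density.indicator hs)]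
  refine lintegral_congr_ae ?_
  filter_upwards [h] with a ha
  rw [← Kernel.withDensity_rnDeriv_eq ha, Kernel.withDensity_apply' _ density,
    ← lintegral_indicator (measurable_prodMk_left hs)]
  rfl

theorem klDiv_compProd_right [MeasurableSpace.CountableOrCountablyGenerated α β]
    (μ : Measure α) [IsFiniteMeasure μ] (κ η : Kernel α β) [IsFiniteKernel κ]
    [IsFiniteKernel η] :
    klDiv (μ ⊗ₘ κ) (μ ⊗ₘ η) = ∫⁻ a, klDiv (κ a) (η a) ∂μ := by
  by_cases h_ac : ∀ᵐ a ∂μ, κ a ≪ η a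
  · have density := κ.measurable_rnDeriv η
    have joint : (μ ⊗ₘ κ).rnDeriv (μ ⊗ₘ η) =ᵐ[μ ⊗ₘ η] fun p => κ.rnDeriv η p.1 p.2 := by
      rw [compProd_eq_withDensity_rnDeriv h_ac]
      exact Measure.rnDeriv_withDensity _ density
    rw [klDiv_eq_lintegral_klFun_of_ac (Measure.absolutelyContinuous_compProd_right_iff.2 h_ac),
      lintegral_congr_ae (g := fun p => ENNReal.ofReal (klFun (κ.rnDeriv η p.1 p.2).toReal))
        (joint.mono fun p hp => by simp only [hp]),
      Measure.lintegral_compProd (by fun_prop)]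
    refine lintegral_congr_ae ?_
    filter_upwards [h_ac] with a ha
    rw [klDiv_eq_lintegral_klFun_of_ac ha]
    exact lintegral_congr_ae
      (Kernel.rnDeriv_eq_rnDeriv_measure.fun_comp fun x => ENNReal.ofReal (klFun x.toReal))
  · rw [klDiv_of_not_ac (mt Measure.absolutelyContinuous_compProd_right_iff.1 h_ac)]
    let singular : Set α := {a | κ a ≪ η a}ᶜ
    have singular_pos : μ singular ≠ 0 := h_ac ∘ ae_iff.2
    refine (eq_top_iff.2 ?_).symm
    calc ∞ = ∫⁻ _ in singular, ∞ ∂μ := by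
          rw [setLIntegral_const, ENNReal.top_mul singular_pos]
      _ = ∫⁻ a in singular, klDiv (κ a) (η a) ∂μ :=
          setLIntegral_congr_fun (Kernel.measurableSet_absolutelyContinuous κ η).compl
            fun a ha => (klDiv_of_not_ac ha).symm
      _ ≤ ∫⁻ a, klDiv (κ a) (η a) ∂μ := setLIntegral_le_lintegral _ _

theorem klDiv_bind_le [MeasurableSpace.CountableOrCountablyGenerated α β]
    (μ : Measure β) [IsProbabilityMeasure μ] (τ γ : Measure α) [IsProbabilityMeasure τ]
    [IsProbabilityMeasure γ] (η : Kernel α β) [IsMarkovKernel η] :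
    klDiv μ (η ∘ₘ γ) ≤ klDiv τ γ + ∫⁻ a, klDiv μ (η a) ∂τ := by
  have snd_joint : (τ ⊗ₘ Kernel.const α μ).snd = μ := by
    rw [Measure.compProd_const, Measure.snd_prod]
  calc klDiv μ (η ∘ₘ γ)
      = klDiv (τ ⊗ₘ Kernel.const α μ).snd (γ ⊗ₘ η).snd := by
        rw [snd_joint, Measure.snd_compProd]
    _ ≤ klDiv (τ ⊗ₘ Kernel.const α μ) (γ ⊗ₘ η) := klDiv_map_le _ _ measurable_snd
    _ = klDiv τ γ + ∫⁻ a, klDiv μ (η a) ∂τ := by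
        rw [klDiv_compProd_eq_add, klDiv_compProd_right]
        simp only [Kernel.const_apply]

end Divergence

section Gaussian

theorem integral_sub_sq_gaussianReal (m : ℝ) (v : ℝ≥0) (t : ℝ) :
    ∫ x, (x - t) ^ 2 ∂gaussianReal m v = v + (m - t) ^ 2 := by
  have moment := variance_id_gaussianReal (μ := m - t) (v := v)
  rw [variance_eq_sub (memLp_id_gaussianReal 2),
    show ∫ x, id x ∂_ = _ from integral_id_gaussianReal] at moment
  rw [← sub_eq_iff_eq_add, ← moment, ← gaussianReal_map_sub_const,
    integral_map (by fun_prop) (by fun_prop)]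
  simp only [Pi.pow_apply, id]

theorem integrable_sub_sq_gaussianReal (m : ℝ) (v : ℝ≥0) (t : ℝ) :
    Integrable (fun x => (x - t) ^ 2) (gaussianReal m v) :=
  ((memLp_id_gaussianReal 2).sub (memLp_const t)).integrable_sq

theorem lintegral_sub_sq_gaussianReal (m : ℝ) (v : ℝ≥0) (t : ℝ) :
    ∫⁻ x, ENNReal.ofReal ((x - t) ^ 2) ∂gaussianReal m v = ENNReal.ofReal (v + (m - t) ^ 2) := by
  rw [← ofReal_integral_eq_lintegral_ofReal (integrable_sub_sq_gaussianReal m v t)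
    (ae_of_all _ fun _ => sq_nonneg _), integral_sub_sq_gaussianReal]

theorem gaussianReal_absolutelyContinuous_gaussianReal (m₁ m₂ : ℝ) {v₁ v₂ : ℝ≥0} (hv₁ : v₁ ≠ 0)
    (hv₂ : v₂ ≠ 0) : gaussianReal m₁ v₁ ≪ gaussianReal m₂ v₂ :=
  (gaussianReal_absolutelyContinuous m₁ hv₁).trans (gaussianReal_absolutelyContinuous' m₂ hv₂)

theorem log_gaussianPDFReal (m : ℝ) {v : ℝ≥0} (hv : v ≠ 0) (x : ℝ) :
    Real.log (gaussianPDFReal m v x)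
      = -(Real.log (2 * Real.pi) + Real.log v) / 2 - (x - m) ^ 2 / (2 * v) := by
  have hv' : (0 : ℝ) < v := by positivity
  rw [gaussianPDFReal, Real.log_mul (by positivity) (Real.exp_ne_zero _), Real.log_exp,
    Real.log_inv, Real.log_sqrt (by positivity), Real.log_mul (by positivity) hv'.ne']
  ring

theorem llr_gaussianReal (m₁ m₂ : ℝ) {v₁ v₂ : ℝ≥0} (hv₁ : v₁ ≠ 0) (hv₂ : v₂ ≠ 0) :
    llr (gaussianReal m₁ v₁) (gaussianReal m₂ v₂) =ᵐ[gaussianReal m₁ v₁] fun x =>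
      Real.log (v₂ / v₁) / 2 + ((x - m₂) ^ 2 / (2 * v₂) - (x - m₁) ^ 2 / (2 * v₁)) := by
  have density : (gaussianReal m₁ v₁).rnDeriv (gaussianReal m₂ v₂) =ᵐ[volume]
      fun x => (gaussianPDF m₂ v₂ x)⁻¹ * (gaussianReal m₁ v₁).rnDeriv volume x := by
    rw [gaussianReal_of_var_ne_zero m₂ hv₂]
    exact Measure.rnDeriv_withDensity_right _ _ (measurable_gaussianPDF m₂ v₂).aemeasurable
      (ae_of_all _ fun x => (gaussianPDF_pos m₂ hv₂ x).ne')
      (ae_of_all _ fun _ => gaussianPDF_ne_top)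
  refine (gaussianReal_absolutelyContinuous m₁ hv₁).ae_le ?_
  filter_upwards [density, rnDeriv_gaussianReal m₁ v₁] with x h_ratio h_pdf
  have pos₁ := gaussianPDFReal_pos m₁ v₁ x hv₁
  have pos₂ := gaussianPDFReal_pos m₂ v₂ x hv₂
  rw [llr, h_ratio, h_pdf, ENNReal.toReal_mul, ENNReal.toReal_inv, toReal_gaussianPDF,
    toReal_gaussianPDF, Real.log_mul (inv_ne_zero pos₂.ne') pos₁.ne', Real.log_inv,
    log_gaussianPDFReal m₁ hv₁, log_gaussianPDFReal m₂ hv₂,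
    Real.log_div (NNReal.coe_ne_zero.2 hv₂) (NNReal.coe_ne_zero.2 hv₁)]
  ring

theorem klDiv_gaussianReal (m₁ m₂ : ℝ) {v₁ v₂ : ℝ≥0} (hv₁ : v₁ ≠ 0) (hv₂ : v₂ ≠ 0) :
    klDiv (gaussianReal m₁ v₁) (gaussianReal m₂ v₂)
      = ENNReal.ofReal ((Real.log (v₂ / v₁) + (v₁ + (m₁ - m₂) ^ 2) / v₂ - 1) / 2) := by
  have h_ac := gaussianReal_absolutelyContinuous_gaussianReal m₁ m₂ hv₁ hv₂
  have h_llr := llr_gaussianReal m₁ m₂ hv₁ hv₂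
  have int₂ := (integrable_sub_sq_gaussianReal m₁ v₁ m₂).div_const (2 * v₂)
  have int₁ := (integrable_sub_sq_gaussianReal m₁ v₁ m₁).div_const (2 * v₁)
  have int_diff : Integrable
      (fun x => (x - m₂) ^ 2 / (2 * v₂ : ℝ) - (x - m₁) ^ 2 / (2 * v₁ : ℝ)) (gaussianReal m₁ v₁) :=
    int₂.sub int₁
  have h_int : Integrable (llr (gaussianReal m₁ v₁) (gaussianReal m₂ v₂)) (gaussianReal m₁ v₁) :=
    ((integrable_const _).add int_diff).congr h_llr.symm
  have hv₁' : (v₁ : ℝ) ≠ 0 := NNReal.coe_ne_zero.2 hv₁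
  rw [← ENNReal.ofReal_toReal (klDiv_ne_top h_ac h_int),
    toReal_klDiv_of_measure_eq h_ac (by simp only [measure_univ]), integral_congr_ae h_llr,
    integral_add (integrable_const _) int_diff, integral_sub int₂ int₁]
  simp only [integral_div, integral_sub_sq_gaussianReal, integral_const, probReal_univ, one_smul,
    sub_self]
  congr 1
  field_simp
  ring

end Gaussian

section Entropy

/-- Shannon entropy, in nats, of a probability measure on a finite type. -/
def entropy {α : Type*} [MeasurableSpace α] (μ : Measure α) : ℝ := ∫ a, -Real.log (μ.real {a}) ∂μ

theorem entropy_nonneg {α : Type*} [MeasurableSpace α] (μ : Measure α) [IsProbabilityMeasure μ] :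
    0 ≤ entropy μ :=
  integral_nonneg fun _ =>
    neg_nonneg.2 (Real.log_nonpos measureReal_nonneg measureReal_le_one)

theorem ae_measureReal_singleton_pos {α : Type*} [Countable α] [MeasurableSpace α]
    (μ : Measure α) [IsFiniteMeasure μ] : ∀ᵐ a ∂μ, 0 < μ.real {a} :=
  ae_iff_of_countable.2 fun _ h => ENNReal.toReal_pos h (measure_ne_top μ _)

variable {α β : Type*} [Finite α] [MeasurableSpace α] [MeasurableSingletonClass α]
  [Finite β] [MeasurableSpace β] [MeasurableSingletonClass β]

theorem toReal_klDiv_add_entropy {μ ν : Measure α} [IsProbabilityMeasure μ]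
    [IsProbabilityMeasure ν] (h : μ ≪ ν) :
    (klDiv μ ν).toReal + entropy μ = ∫ a, -Real.log (ν.real {a}) ∂μ := by
  have llr_eq : llr μ ν =ᵐ[μ] fun a => Real.log (μ.real {a}) - Real.log (ν.real {a}) := by
    filter_upwards [ae_measureReal_singleton_pos μ, h.ae_le (ae_measureReal_singleton_pos ν)]
      with a hμ hν
    have mass : μ.real {a} = (μ.rnDeriv ν a).toReal * ν.real {a} := by
      rw [measureReal_def, ← Measure.setLIntegral_rnDeriv h, lintegral_singleton,
        ENNReal.toReal_mul, measureReal_def]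
    rw [llr, ← Real.log_div hμ.ne' hν.ne', mass, mul_div_cancel_right₀ _ hν.ne']
  rw [toReal_klDiv_of_measure_eq h (by simp only [measure_univ]), integral_congr_ae llr_eq, entropy,
    ← integral_add Integrable.of_finite Integrable.of_finite]
  simp only [← sub_eq_add_neg, sub_sub_cancel_left]

theorem uniformOn_univ_real_singleton [Nonempty α] (a : α) :
    (uniformOn (Set.univ : Set α)).real {a} = (Nat.card α : ℝ)⁻¹ := by
  have := Fintype.ofFinite α
  rw [measureReal_def, uniformOn_univ, Measure.count_singleton, one_div, ENNReal.toReal_inv,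
    ENNReal.toReal_natCast, Nat.card_eq_fintype_card]

theorem absolutelyContinuous_uniformOn_univ (μ : Measure α) : μ ≪ uniformOn Set.univ := by
  refine Measure.AbsolutelyContinuous.mk fun s _ hs => ?_
  rw [uniformOn_eq_zero_iff Set.finite_univ, Set.univ_inter] at hs
  rw [hs, measure_empty]

theorem toReal_klDiv_uniformOn_univ_add_entropy (μ : Measure α) [IsProbabilityMeasure μ] :
    (klDiv μ (uniformOn Set.univ)).toReal + entropy μ = Real.log (Nat.card α) := by
  have := μ.nonempty_of_neZero
  have := isProbabilityMeasure_uniformOn (Set.finite_univ (α := α)) Set.univ_nonempty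
  rw [toReal_klDiv_add_entropy (absolutelyContinuous_uniformOn_univ μ)]
  simp only [uniformOn_univ_real_singleton, Real.log_inv, neg_neg, integral_const, probReal_univ,
    one_smul]

theorem entropy_le_log_card (μ : Measure α) [IsProbabilityMeasure μ] :
    entropy μ ≤ Real.log (Nat.card α) := by
  rw [← toReal_klDiv_uniformOn_univ_add_entropy μ]
  exact le_add_of_nonneg_left ENNReal.toReal_nonneg

theorem entropy_map_le (μ : Measure α) [IsFiniteMeasure μ] (f : α → β) :
    entropy (μ.map f) ≤ entropy μ := by
  have hf : Measurable f := .of_discrete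
  rw [entropy, integral_map hf.aemeasurable Measurable.of_discrete.aestronglyMeasurable]
  refine integral_mono_ae Integrable.of_finite Integrable.of_finite ?_
  filter_upwards [ae_measureReal_singleton_pos μ] with a ha
  have h_le : μ.real {a} ≤ (μ.map f).real {f a} := by
    rw [map_measureReal_apply hf (measurableSet_singleton _)]
    exact measureReal_mono (Set.singleton_subset_iff.2 rfl)
  exact neg_le_neg (Real.log_le_log ha h_le)

theorem klDiv_ne_top_of_finite {μ ν : Measure α} [IsFiniteMeasure μ] (h : μ ≪ ν) :
    klDiv μ ν ≠ ∞ :=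
  klDiv_ne_top h Integrable.of_finite

theorem absolutelyContinuous_prod_of_countable {α β : Type*} [Countable α] [MeasurableSpace α]
    [Countable β] [MeasurableSpace β] [MeasurableSingletonClass α] [MeasurableSingletonClass β]
    {μ : Measure (α × β)} {ν₁ : Measure α} {ν₂ : Measure β} [SFinite ν₂] (h₁ : μ.fst ≪ ν₁)
    (h₂ : μ.snd ≪ ν₂) : μ ≪ ν₁.prod ν₂ := by
  refine Measure.AbsolutelyContinuous.mk fun s _ hs =>
    (measure_null_iff_singleton s.to_countable).2 fun ⟨a, b⟩ hab => ?_
  have null : ν₁ {a} * ν₂ {b} = 0 := by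
    rw [← Measure.prod_prod, Set.singleton_prod_singleton]
    exact measure_mono_null (Set.singleton_subset_iff.2 hab) hs
  rcases mul_eq_zero.1 null with h | h
  · have := h₁ h
    rw [Measure.fst_apply (measurableSet_singleton a)] at this
    exact measure_mono_null (by rintro _ rfl; rfl) this
  · have := h₂ h
    rw [Measure.snd_apply (measurableSet_singleton b)] at this
    exact measure_mono_null (by rintro _ rfl; rfl) this

theorem toReal_klDiv_prod_add_entropy {μ : Measure (α × β)} [IsProbabilityMeasure μ]
    {ν₁ : Measure α} {ν₂ : Measure β} [IsProbabilityMeasure ν₁] [IsProbabilityMeasure ν₂]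
    (h₁ : μ.fst ≪ ν₁) (h₂ : μ.snd ≪ ν₂) :
    (klDiv μ (ν₁.prod ν₂)).toReal + entropy μ
      = ((klDiv μ.fst ν₁).toReal + entropy μ.fst) + ((klDiv μ.snd ν₂).toReal + entropy μ.snd) := by
  have h := absolutelyContinuous_prod_of_countable h₁ h₂
  have h_log : (fun p => -Real.log ((ν₁.prod ν₂).real {p})) =ᵐ[μ]
      fun p => -Real.log (ν₁.real {p.1}) + -Real.log (ν₂.real {p.2}) := by
    filter_upwards [h.ae_le (ae_measureReal_singleton_pos _)] with ⟨a, b⟩ hab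
    rw [← Set.singleton_prod_singleton, measureReal_prod_prod] at hab ⊢
    rw [Real.log_mul (left_ne_zero_of_mul hab.ne') (right_ne_zero_of_mul hab.ne'), neg_add]
  rw [toReal_klDiv_add_entropy h, toReal_klDiv_add_entropy h₁, toReal_klDiv_add_entropy h₂,
    integral_congr_ae h_log, integral_add Integrable.of_finite Integrable.of_finite,
    Measure.fst, Measure.snd,
    integral_map measurable_fst.aemeasurable Measurable.of_discrete.aestronglyMeasurable,
    integral_map measurable_snd.aemeasurable Measurable.of_discrete.aestronglyMeasurable]

theorem klDiv_prod_le (μ : Measure (α × β)) [IsProbabilityMeasure μ] (ν₁ : Measure α)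
    (ν₂ : Measure β) [IsProbabilityMeasure ν₁] [IsProbabilityMeasure ν₂] :
    klDiv μ (ν₁.prod ν₂) ≤ ENNReal.ofReal (entropy μ) + (klDiv μ.fst ν₁ + klDiv μ.snd ν₂) := by
  by_cases h₁ : μ.fst ≪ ν₁
  swap; · simp only [klDiv_of_not_ac h₁, top_add, add_top, le_top]
  by_cases h₂ : μ.snd ≪ ν₂
  swap; · simp only [klDiv_of_not_ac h₂, add_top, le_top]
  have chain := toReal_klDiv_prod_add_entropy h₁ h₂
  have le₁ : entropy μ.fst ≤ entropy μ := entropy_map_le μ Prod.fst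
  have le₂ : entropy μ.snd ≤ entropy μ := entropy_map_le μ Prod.snd
  rw [← ENNReal.ofReal_toReal (klDiv_ne_top_of_finite h₁),
    ← ENNReal.ofReal_toReal (klDiv_ne_top_of_finite h₂),
    ← ENNReal.ofReal_add ENNReal.toReal_nonneg ENNReal.toReal_nonneg,
    ← ENNReal.ofReal_add (entropy_nonneg μ) (by positivity),
    ENNReal.le_ofReal_iff_toReal_le
      (klDiv_ne_top_of_finite (absolutelyContinuous_prod_of_countable h₁ h₂))
      (add_nonneg (entropy_nonneg μ) (by positivity))]
  linarith

theorem ofReal_le_klDiv_of_event {Ω : Type*} [MeasurableSpace Ω] (ρ π : Measure Ω)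
    [IsProbabilityMeasure ρ] [IsProbabilityMeasure π] {E : Set Ω} (hE : MeasurableSet E) :
    ENNReal.ofReal (ρ.real E * -Real.log (π.real E) - Real.log 2) ≤ klDiv ρ π := by
  by_cases h_ac : ρ ≪ π
  swap; · simp only [klDiv_of_not_ac h_ac, le_top]
  have indicator : Measurable (· ∈ E) := measurable_mem.2 hE
  have := Measure.isProbabilityMeasure_map (μ := ρ) indicator.aemeasurable
  have := Measure.isProbabilityMeasure_map (μ := π) indicator.aemeasurable
  have apply_true (μ : Measure Ω) : (μ.map (· ∈ E)).real {True} = μ.real E := by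
    rw [map_measureReal_apply indicator (measurableSet_singleton _)]
    congr; ext; simp
  refine le_trans ?_ (klDiv_map_le ρ π indicator)
  rw [ENNReal.ofReal_le_iff_le_toReal (klDiv_ne_top_of_finite (h_ac.map indicator))]
  have cross := toReal_klDiv_add_entropy (h_ac.map indicator)
  have bit := entropy_le_log_card (ρ.map (· ∈ E))
  have on_event : ρ.real E * -Real.log (π.real E) ≤
      ∫ a, -Real.log ((π.map (· ∈ E)).real {a}) ∂(ρ.map (· ∈ E)) := by
    rw [← apply_true, ← apply_true, ← smul_eq_mul, ← integral_singleton
      (fun a => -Real.log ((π.map (· ∈ E)).real {a})) True]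
    exact setIntegral_le_integral Integrable.of_finite
      (ae_of_all _ fun _ => neg_nonneg.2 (Real.log_nonpos measureReal_nonneg measureReal_le_one))
  rw [Nat.card_eq_fintype_card, Fintype.card_prop] at bit
  push_cast at bit
  linarith

theorem ofReal_le_klDiv_of_event_of_le {Ω : Type*} [MeasurableSpace Ω] {ρ π : Measure Ω}
    [IsProbabilityMeasure ρ] [IsProbabilityMeasure π] {E : Set Ω} (hE : MeasurableSet E) {p q : ℝ}
    (hp : 0 < p) (hρ : p ≤ ρ.real E) (hπ : π.real E ≤ q) :
    ENNReal.ofReal (p * -Real.log q - Real.log 2) ≤ klDiv ρ π := by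
  by_cases h_ac : ρ ≪ π
  swap; · simp only [klDiv_of_not_ac h_ac, le_top]
  have π_pos : 0 < π.real E := ENNReal.toReal_pos (fun h_null =>
    (hp.trans_le hρ).ne' (by rw [measureReal_def, h_ac h_null, ENNReal.toReal_zero]))
    (measure_ne_top π E)
  refine (ENNReal.ofReal_le_ofReal (sub_le_sub_right ?_ _)).trans
    (ofReal_le_klDiv_of_event ρ π hE)
  calc p * -Real.log q ≤ p * -Real.log (π.real E) := by gcongr
    _ ≤ ρ.real E * -Real.log (π.real E) := by
      gcongr
      exact neg_nonneg.2 (Real.log_nonpos π_pos.le measureReal_le_one)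

theorem ofReal_le_mutualInfo_of_closedBall_le {α β : Type*} [PseudoMetricSpace α]
    [SecondCountableTopology α] [MeasurableSpace α] [OpensMeasurableSpace α] [MeasurableSpace β]
    {ρ : Measure (α × β)} [IsProbabilityMeasure ρ] {g : β → α} (hg : Measurable g) {r p q : ℝ}
    (hp : 0 < p) (h_close : p ≤ ρ.real {x | dist x.1 (g x.2) ≤ r}) (hq : 0 ≤ q)
    (h_spread : ∀ y, ρ.fst (Metric.closedBall y r) ≤ ENNReal.ofReal q) :
    ENNReal.ofReal ((p * -Real.log q - Real.log 2) / Real.log 2) ≤ mutualInfo ρ := by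
  have measurable_event : MeasurableSet {x : α × β | dist x.1 (g x.2) ≤ r} :=
    measurableSet_le (by fun_prop) measurable_const
  have independent : (ρ.fst.prod ρ.snd).real {x | dist x.1 (g x.2) ≤ r} ≤ q := by
    refine ENNReal.toReal_le_of_le_ofReal hq ?_
    rw [Measure.prod_apply_symm measurable_event]
    calc ∫⁻ y, ρ.fst (Metric.closedBall (g y) r) ∂ρ.snd
        ≤ ∫⁻ _, ENNReal.ofReal q ∂ρ.snd := lintegral_mono fun y => h_spread (g y)
      _ = ENNReal.ofReal q := by rw [lintegral_const, measure_univ, mul_one]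
  rw [mutualInfo, ENNReal.ofReal_div_of_pos (Real.log_pos one_lt_two)]
  exact ENNReal.div_le_div_right
    (ofReal_le_klDiv_of_event_of_le measurable_event hp h_close independent) _

end Entropy

section Channel

variable {W M : Type*} [MeasurableSpace W] [MeasurableSpace M]

/-- Mutual information, in nats, between the input and the output of the channel `κ` when the input
has law `P`. -/
def channelInfo (P : Measure W) (κ : Kernel W M) : ℝ≥0∞ := klDiv (P ⊗ₘ κ) (P.prod (κ ∘ₘ P))

theorem channelInfo_add_klDiv [StandardBorelSpace W] [Nonempty W] (P : Measure W)
    [IsProbabilityMeasure P] (κ : Kernel W M) [IsMarkovKernel κ] (Q : Measure M)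
    [IsProbabilityMeasure Q] :
    channelInfo P κ + klDiv (κ ∘ₘ P) Q = klDiv (P ⊗ₘ κ) (P.prod Q) := by
  have swap_klDiv (ν : Measure M) [IsProbabilityMeasure ν] :
      klDiv (P ⊗ₘ κ) (P.prod ν) = klDiv ((κ ∘ₘ P) ⊗ₘ (κ†P)) (ν ⊗ₘ Kernel.const M P) := by
    have swap : (P.prod ν).map MeasurableEquiv.prodComm = ν.prod P := Measure.prod_swap
    rw [← klDiv_map_measurableEquiv MeasurableEquiv.prodComm, compProd_posterior_eq_map_swap,
      Measure.compProd_const, swap]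
    rfl
  rw [channelInfo, swap_klDiv, swap_klDiv, klDiv_compProd_eq_add (κ ∘ₘ P) Q, add_comm]

theorem channelInfo_le_lintegral_klDiv [StandardBorelSpace W] [Nonempty W]
    [MeasurableSpace.CountableOrCountablyGenerated W M] (P : Measure W)
    [IsProbabilityMeasure P] (κ : Kernel W M) [IsMarkovKernel κ] (Q : Measure M)
    [IsProbabilityMeasure Q] :
    channelInfo P κ ≤ ∫⁻ w, klDiv (κ w) Q ∂P := by
  calc channelInfo P κ
      ≤ channelInfo P κ + klDiv (κ ∘ₘ P) Q := le_self_add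
    _ = klDiv (P ⊗ₘ κ) (P ⊗ₘ Kernel.const W Q) := by
        rw [channelInfo_add_klDiv, Measure.compProd_const]
    _ = ∫⁻ w, klDiv (κ w) Q ∂P := klDiv_compProd_right P κ (Kernel.const W Q)

variable [Finite W] [MeasurableSingletonClass W] [Nonempty W]

theorem fano (κ : Kernel W M) [IsMarkovKernel κ] {dec : M → W} (h_dec : Measurable dec) :
    ENNReal.ofReal ((uniformOn Set.univ ⊗ₘ κ).real {p | dec p.2 = p.1} * Real.log (Nat.card W)
        - Real.log 2) ≤ channelInfo (uniformOn Set.univ) κ := by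
  have := isProbabilityMeasure_uniformOn (Set.finite_univ (α := W)) Set.univ_nonempty
  have correct_meas : MeasurableSet {p : W × M | dec p.2 = p.1} :=
    measurableSet_eq_fun (h_dec.comp measurable_snd) measurable_fst
  have guess : ((uniformOn Set.univ).prod (κ ∘ₘ uniformOn Set.univ)).real
      {p : W × M | dec p.2 = p.1} = (Nat.card W : ℝ)⁻¹ := by
    have fiber (m : M) : (fun w => (w, m)) ⁻¹' {p : W × M | dec p.2 = p.1} = {dec m} := by
      ext w; exact eq_comm
    have mass (w : W) : uniformOn Set.univ {w} = ENNReal.ofReal (Nat.card W : ℝ)⁻¹ := by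
      rw [← uniformOn_univ_real_singleton w, ofReal_measureReal]
    rw [measureReal_def, Measure.prod_apply_symm correct_meas]
    simp only [fiber, mass, lintegral_const, measure_univ, mul_one]
    exact ENNReal.toReal_ofReal (by positivity)
  have h := ofReal_le_klDiv_of_event (uniformOn Set.univ ⊗ₘ κ)
    ((uniformOn Set.univ).prod (κ ∘ₘ uniformOn Set.univ)) correct_meas
  rwa [guess, Real.log_inv, neg_neg] at h

theorem channelInfo_add_lintegral_entropy_le [Finite M] [MeasurableSingletonClass M] [Nonempty M]
    (P : Measure W) [IsProbabilityMeasure P] (κ : Kernel W M) [IsMarkovKernel κ] :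
    channelInfo P κ + ∫⁻ w, ENNReal.ofReal (entropy (κ w)) ∂P
      ≤ ENNReal.ofReal (Real.log (Nat.card M)) := by
  have := isProbabilityMeasure_uniformOn (Set.finite_univ (α := M)) Set.univ_nonempty
  calc channelInfo P κ + ∫⁻ w, ENNReal.ofReal (entropy (κ w)) ∂P
      ≤ ∫⁻ w, klDiv (κ w) (uniformOn Set.univ) ∂P
          + ∫⁻ w, ENNReal.ofReal (entropy (κ w)) ∂P := by
        gcongr; exact channelInfo_le_lintegral_klDiv P κ _
    _ = ∫⁻ _, ENNReal.ofReal (Real.log (Nat.card M)) ∂P := by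
        rw [← lintegral_add_left .of_discrete]
        refine lintegral_congr fun w => ?_
        have h_ac := absolutelyContinuous_uniformOn_univ (κ w)
        rw [← toReal_klDiv_uniformOn_univ_add_entropy (κ w),
          ENNReal.ofReal_add ENNReal.toReal_nonneg (entropy_nonneg _),
          ENNReal.ofReal_toReal (klDiv_ne_top_of_finite h_ac)]
    _ = ENNReal.ofReal (Real.log (Nat.card M)) := by
        rw [lintegral_const, measure_univ, mul_one]

variable {A B T : Type*} [Finite A] [MeasurableSpace A] [MeasurableSingletonClass A]
  [Finite B] [MeasurableSpace B] [MeasurableSingletonClass B] [MeasurableSpace T]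

theorem two_mul_channelInfo_le (P : Measure W) [IsProbabilityMeasure P] (κ : Kernel W (A × B))
    [IsMarkovKernel κ] (τ : Kernel W T) [IsMarkovKernel τ] (γ : Measure T) [IsProbabilityMeasure γ]
    (η₁ : Kernel T A) (η₂ : Kernel T B) [IsMarkovKernel η₁] [IsMarkovKernel η₂] :
    2 * channelInfo P κ ≤ ENNReal.ofReal (Real.log (Nat.card (A × B)))
      + ∫⁻ w, (klDiv (τ w) γ
          + ∫⁻ t, (klDiv (κ w).fst (η₁ t) + klDiv (κ w).snd (η₂ t)) ∂τ w) ∂P := by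
  have : Nonempty (A × B) := ‹Nonempty W›.elim fun w => (κ w).nonempty_of_neZero
  have pointwise (w : W) : klDiv (κ w) ((η₁ ×ₖ η₂) ∘ₘ γ) ≤ ENNReal.ofReal (entropy (κ w))
      + (klDiv (τ w) γ + ∫⁻ t, (klDiv (κ w).fst (η₁ t) + klDiv (κ w).snd (η₂ t)) ∂τ w) := by
    calc klDiv (κ w) ((η₁ ×ₖ η₂) ∘ₘ γ)
        ≤ klDiv (τ w) γ + ∫⁻ t, klDiv (κ w) ((η₁ ×ₖ η₂) t) ∂τ w := klDiv_bind_le _ _ _ _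
      _ ≤ klDiv (τ w) γ + ∫⁻ t, (ENNReal.ofReal (entropy (κ w))
            + (klDiv (κ w).fst (η₁ t) + klDiv (κ w).snd (η₂ t))) ∂τ w := by
          gcongr with t
          rw [Kernel.prod_apply]
          exact klDiv_prod_le _ _ _
      _ = _ := by
          rw [lintegral_add_left measurable_const, lintegral_const, measure_univ, mul_one,
            add_left_comm]
  calc 2 * channelInfo P κ
      ≤ channelInfo P κ + ∫⁻ w, klDiv (κ w) ((η₁ ×ₖ η₂) ∘ₘ γ) ∂P := by
        rw [two_mul]; gcongr; exact channelInfo_le_lintegral_klDiv P κ _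
    _ ≤ channelInfo P κ + (∫⁻ w, ENNReal.ofReal (entropy (κ w)) ∂P
          + ∫⁻ w, (klDiv (τ w) γ
            + ∫⁻ t, (klDiv (κ w).fst (η₁ t) + klDiv (κ w).snd (η₂ t)) ∂τ w) ∂P) := by
        rw [← lintegral_add_left .of_discrete]
        gcongr with w
        exact pointwise w
    _ ≤ _ := by
        rw [← add_assoc]
        gcongr
        exact channelInfo_add_lintegral_entropy_le P κ

end Channel

section GaussianVector

variable {n : ℕ}

/-- The memoryless channel `y k = a * t k + z k`, with independent centred Gaussian noise of
variance `v`, over `n` uses. -/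
def gaussianChannel (n : ℕ) (a : ℝ) (v : ℝ≥0) : Kernel (Fin n → ℝ) (Fin n → ℝ) :=
  (Kernel.id ×ₖ Kernel.const _ (Measure.pi fun _ => gaussianReal 0 v)).map
    fun p k => a * p.1 k + p.2 k

instance (n : ℕ) (a : ℝ) (v : ℝ≥0) : IsMarkovKernel (gaussianChannel n a v) :=
  Kernel.IsMarkovKernel.map _ (by fun_prop)

theorem gaussianChannel_apply (a : ℝ) (v : ℝ≥0) (t : Fin n → ℝ) :
    gaussianChannel n a v t = Measure.pi fun k => gaussianReal (a * t k) v := by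
  have shift (k : Fin n) : (gaussianReal 0 v).map (a * t k + ·) = gaussianReal (a * t k) v := by
    rw [gaussianReal_map_const_add, zero_add]
  have (k : Fin n) : IsProbabilityMeasure ((gaussianReal 0 v).map (a * t k + ·)) := by
    rw [shift]; infer_instance
  rw [gaussianChannel, Kernel.map_apply _ (by fun_prop), Kernel.prod_apply, Kernel.id_apply,
    Kernel.const_apply, Measure.dirac_prod, Measure.map_map (by fun_prop) (by fun_prop)]
  simp only [← shift]
  exact Measure.pi_map_pi fun k => (measurable_const_add (a * t k)).aemeasurable

theorem div_add_le_log_one_add_div {p q : ℝ} (hp : 0 ≤ p) (hq : 0 < q) :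
    p / (q + p) ≤ Real.log (1 + p / q) := by
  have h_inv : 1 - (1 + p / q)⁻¹ = p / (q + p) := by field_simp; ring
  exact h_inv ▸ Real.one_sub_inv_le_log_of_pos (by positivity)

theorem klDiv_pi_gaussianReal_add_variance (x : Fin n → ℝ) {q : ℝ≥0} (hq : q ≠ 0) (p : ℝ≥0) :
    klDiv (Measure.pi fun k => gaussianReal (x k) q)
        (Measure.pi fun _ : Fin n => gaussianReal 0 (q + p))
      = ENNReal.ofReal (n * (Real.log (1 + p / q) / 2 - p / (q + p) / 2))
        + ENNReal.ofReal ((∑ k, x k ^ 2) / (2 * (q + p))) := by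
  have hq' : (0 : ℝ) < q := by positivity
  have const_nonneg : 0 ≤ Real.log (1 + p / q) / 2 - p / (q + p) / 2 := by
    linarith [div_add_le_log_one_add_div p.coe_nonneg hq']
  have coord (k : Fin n) : klDiv (gaussianReal (x k) q) (gaussianReal 0 (q + p))
      = ENNReal.ofReal (Real.log (1 + p / q) / 2 - p / (q + p) / 2)
        + ENNReal.ofReal (x k ^ 2 / (2 * (q + p))) := by
    rw [klDiv_gaussianReal _ _ hq (by positivity), NNReal.coe_add, add_div, div_self hq'.ne',
      ← ENNReal.ofReal_add const_nonneg (by positivity)]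
    congr 1
    field_simp
    ring
  rw [klDiv_pi]
  simp only [coord, Finset.sum_add_distrib, Finset.sum_const, Finset.card_univ, Fintype.card_fin,
    nsmul_eq_mul]
  rw [← ENNReal.ofReal_sum_of_nonneg fun k _ => by positivity, Finset.sum_div,
    ENNReal.ofReal_mul (Nat.cast_nonneg n), ENNReal.ofReal_natCast]

theorem klDiv_gaussianChannel (a : ℝ) {v : ℝ≥0} (hv : v ≠ 0) (x t : Fin n → ℝ) :
    klDiv (gaussianChannel n a v x) (gaussianChannel n a v t)
      = ∑ k, ENNReal.ofReal (a ^ 2 / (2 * v)) * ENNReal.ofReal ((t k - x k) ^ 2) := by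
  have hv' : (0 : ℝ) < v := by positivity
  simp only [gaussianChannel_apply, klDiv_pi]
  refine Finset.sum_congr rfl fun k _ => ?_
  rw [klDiv_gaussianReal _ _ hv hv, div_self hv'.ne', Real.log_one,
    ← ENNReal.ofReal_mul (by positivity)]
  congr 1
  field_simp
  ring

theorem measurable_klDiv_gaussianChannel (a : ℝ) {v : ℝ≥0} (hv : v ≠ 0) (x : Fin n → ℝ) :
    Measurable fun t => klDiv (gaussianChannel n a v x) (gaussianChannel n a v t) := by
  simp only [klDiv_gaussianChannel a hv]
  fun_prop

theorem lintegral_klDiv_gaussianChannel_le (a : ℝ) {v q : ℝ≥0} (hv : v ≠ 0) (hqv : q ≤ v)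
    (x : Fin n → ℝ) :
    ∫⁻ t, klDiv (gaussianChannel n a v x) (gaussianChannel n a v t)
        ∂(Measure.pi fun k => gaussianReal (x k) q)
      ≤ ENNReal.ofReal (n * (a ^ 2 / 2)) := by
  have average (k : Fin n) :
      ∫⁻ t, ENNReal.ofReal (a ^ 2 / (2 * v)) * ENNReal.ofReal ((t k - x k) ^ 2)
        ∂(Measure.pi fun k => gaussianReal (x k) q) = ENNReal.ofReal (a ^ 2 / (2 * v) * q) := by
    rw [lintegral_const_mul _ (by fun_prop),
      (measurePreserving_eval (fun k => gaussianReal (x k) q) k).lintegral_comp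
        (f := fun t => ENNReal.ofReal ((t - x k) ^ 2)) (by fun_prop),
      lintegral_sub_sq_gaussianReal, sub_self, zero_pow two_ne_zero, add_zero,
      ENNReal.ofReal_mul (by positivity)]
  have h_ratio : a ^ 2 / (2 * v) * q ≤ a ^ 2 / 2 := by
    rw [div_mul_eq_mul_div, div_le_div_iff₀ (by positivity) two_pos]
    nlinarith [mul_le_mul_of_nonneg_left (NNReal.coe_le_coe.2 hqv) (sq_nonneg a)]
  simp only [klDiv_gaussianChannel a hv]
  rw [lintegral_finsetSum _ fun k _ => by fun_prop]
  simp only [average, Finset.sum_const, Finset.card_univ, Fintype.card_fin, nsmul_eq_mul]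
  rw [← ENNReal.ofReal_natCast, ← ENNReal.ofReal_mul (Nat.cast_nonneg n)]
  gcongr

end GaussianVector

section OutputLaw

theorem map_prod_gaussianReal_const_add (c : ℝ) (v₁ v₂ : ℝ≥0) :
    ((gaussianReal 0 v₁).prod (gaussianReal 0 v₂)).map (fun p => c + p.1 + p.2)
      = gaussianReal c (v₁ + v₂) := by
  have sum : ((gaussianReal 0 v₁).prod (gaussianReal 0 v₂)).map (fun p => p.1 + p.2)
      = gaussianReal 0 (v₁ + v₂) := by
    rw [← Measure.conv, gaussianReal_conv_gaussianReal, add_zero]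
  simp only [add_assoc]
  rw [← zero_add c, ← gaussianReal_map_const_add, ← sum,
    Measure.map_map (by fun_prop) (by fun_prop), zero_add]
  rfl

namespace Network

variable (N : Network)

instance : IsProbabilityMeasure N.noise := by unfold noise; infer_instance

instance (n : ℕ) : IsProbabilityMeasure (N.noiseN n) := by unfold noiseN; infer_instance

@[fun_prop]
theorem measurable_out1 (x : ℝ) : Measurable (N.out1 x) := by unfold out1; fun_prop

@[fun_prop]
theorem measurable_out2 (x : ℝ) : Measurable (N.out2 x) := by unfold out2; fun_prop

theorem map_out1_noise (x : ℝ) :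
    N.noise.map (N.out1 x) = gaussianReal (N.a * x) (N.PJ + N.PN1) := by
  have marginal : N.noise.map (Prod.map id Prod.fst)
      = (gaussianReal 0 N.PJ).prod (gaussianReal 0 N.PN1) := by
    rw [noise, ← Measure.map_prod_map _ _ measurable_id measurable_fst, Measure.map_id,
      Measure.map_fst_prod, measure_univ, one_smul]
  rw [← map_prod_gaussianReal_const_add, ← marginal, Measure.map_map (by fun_prop) (by fun_prop)]
  rfl

theorem map_out2_noise (x : ℝ) :
    N.noise.map (N.out2 x) = gaussianReal (N.b * x) (N.PJ + N.PN2) := by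
  have marginal : N.noise.map (Prod.map id Prod.snd)
      = (gaussianReal 0 N.PJ).prod (gaussianReal 0 N.PN2) := by
    rw [noise, ← Measure.map_prod_map _ _ measurable_id measurable_snd, Measure.map_id,
      Measure.map_snd_prod, measure_univ, one_smul]
  rw [← map_prod_gaussianReal_const_add, ← marginal, Measure.map_map (by fun_prop) (by fun_prop)]
  rfl

theorem map_out1_noiseN {n : ℕ} (x : Fin n → ℝ) :
    (N.noiseN n).map (fun z k => N.out1 (x k) (z k)) = gaussianChannel n N.a (N.PJ + N.PN1) x := by
  have (k : Fin n) : IsProbabilityMeasure (N.noise.map (N.out1 (x k))) :=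
    Measure.isProbabilityMeasure_map (by fun_prop)
  rw [noiseN, Measure.pi_map_pi fun k => (N.measurable_out1 (x k)).aemeasurable,
    gaussianChannel_apply]
  simp only [map_out1_noise]

theorem map_out2_noiseN {n : ℕ} (x : Fin n → ℝ) :
    (N.noiseN n).map (fun z k => N.out2 (x k) (z k)) = gaussianChannel n N.b (N.PJ + N.PN2) x := by
  have (k : Fin n) : IsProbabilityMeasure (N.noise.map (N.out2 (x k))) :=
    Measure.isProbabilityMeasure_map (by fun_prop)
  rw [noiseN, Measure.pi_map_pi fun k => (N.measurable_out2 (x k)).aemeasurable,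
    gaussianChannel_apply]
  simp only [map_out2_noise]

end Network

end OutputLaw

section NumIndices

variable {r : ℝ}

theorem numIndices_pos_iff : 0 < numIndices r ↔ 0 ≤ r := by
  rw [numIndices, Nat.floor_pos]
  refine ⟨fun h => (Real.rpow_le_rpow_left_iff one_lt_two).1 ?_, Real.one_le_rpow one_le_two⟩
  rwa [Real.rpow_zero]

theorem log_numIndices_le (hr : 0 ≤ r) : Real.log (numIndices r) ≤ r * Real.log 2 := by
  rw [← Real.log_rpow two_pos]
  exact Real.log_le_log (Nat.cast_pos.2 (numIndices_pos_iff.2 hr)) (Nat.floor_le (by positivity))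

theorem le_log_numIndices (hr : 0 ≤ r) : (r - 1) * Real.log 2 ≤ Real.log (numIndices r) := by
  have h_one : (1 : ℝ) ≤ numIndices r := Nat.one_le_cast.2 (numIndices_pos_iff.2 hr)
  have h_floor : (2 : ℝ) ^ r < numIndices r + 1 := Nat.lt_floor_add_one _
  rw [← Real.log_rpow two_pos, Real.rpow_sub two_pos, Real.rpow_one]
  exact Real.log_le_log (by positivity) (by linarith)

end NumIndices

section Converse

theorem integral_uniformOn_univ {ι : Type*} [Fintype ι] [Nonempty ι] [MeasurableSpace ι]
    [MeasurableSingletonClass ι] (f : ι → ℝ) :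
    ∫ i, f i ∂uniformOn Set.univ = (∑ i, f i) / Fintype.card ι := by
  have := isProbabilityMeasure_uniformOn (Set.finite_univ (α := ι)) Set.univ_nonempty
  rw [integral_fintype .of_finite]
  simp only [uniformOn_univ_real_singleton, Nat.card_eq_fintype_card, smul_eq_mul,
    inv_mul_eq_div, Finset.sum_div]

theorem compProd_uniformOn_univ_real {ι β : Type*} [Fintype ι] [Nonempty ι] [MeasurableSpace ι]
    [MeasurableSingletonClass ι] [MeasurableSpace β] (κ : Kernel ι β) [IsMarkovKernel κ]
    {s : Set (ι × β)} (hs : MeasurableSet s) :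
    (uniformOn Set.univ ⊗ₘ κ).real s = (∑ i, (κ i).real (Prod.mk i ⁻¹' s)) / Fintype.card ι := by
  have := isProbabilityMeasure_uniformOn (Set.finite_univ (α := ι)) Set.univ_nonempty
  rw [measureReal_def, Measure.compProd_apply hs, ← integral_toReal
    Measurable.of_discrete.aemeasurable (ae_of_all _ fun i => measure_lt_top _ _),
    integral_uniformOn_univ]
  rfl

/-- The upper bound on achievable rates, in bits, obtained by revealing to the destination the
input perturbed by Gaussian noise of variance `PJ`. -/
def Network.ditherBound (N : Network) : ℝ :=
  (N.C1 + N.C2 + Real.logb 2 (1 + N.PX / N.PJ) / 2) / 2 + (N.a ^ 2 + N.b ^ 2) / (4 * Real.log 2)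

namespace Network.Code

variable {N : Network} {n : ℕ} {R : ℝ}

theorem mul_C1_nonneg (c : N.Code n R) : 0 ≤ n * N.C1 := numIndices_pos_iff.1 (Fin.pos (c.relay1 0))

theorem mul_C2_nonneg (c : N.Code n R) : 0 ≤ n * N.C2 := numIndices_pos_iff.1 (Fin.pos (c.relay2 0))

theorem mul_ditherBound_nonneg (c : N.Code n R) : 0 ≤ n * N.ditherBound := by
  have h_ratio : (1 : ℝ) ≤ 1 + N.PX / N.PJ := le_add_of_nonneg_right (by positivity)
  have rate_nonneg : 0 ≤ n * Real.logb 2 (1 + N.PX / N.PJ) :=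
    mul_nonneg (Nat.cast_nonneg n) (Real.logb_nonneg one_lt_two h_ratio)
  have cost_nonneg : 0 ≤ n * ((N.a ^ 2 + N.b ^ 2) / (4 * Real.log 2)) := by positivity
  rw [ditherBound]
  linarith [c.mul_C1_nonneg, c.mul_C2_nonneg]

variable (c : N.Code n R)

/-- The channel from the message to the pair of indices which the relays send to the
destination. -/
def channel : Kernel (Fin (numIndices (n * R)))
    (Fin (numIndices (n * N.C1)) × Fin (numIndices (n * N.C2))) :=
  Kernel.ofFunOfCountable fun w => (N.noiseN n).map fun z =>
    (c.relay1 fun k => N.out1 (c.enc w k) (z k), c.relay2 fun k => N.out2 (c.enc w k) (z k))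

@[fun_prop]
theorem measurable_relay1_out1 (x : Fin n → ℝ) :
    Measurable fun z : Fin n → ℝ × ℝ × ℝ => c.relay1 fun k => N.out1 (x k) (z k) :=
  c.measurable_relay1.comp (by fun_prop)

@[fun_prop]
theorem measurable_relay2_out2 (x : Fin n → ℝ) :
    Measurable fun z : Fin n → ℝ × ℝ × ℝ => c.relay2 fun k => N.out2 (x k) (z k) :=
  c.measurable_relay2.comp (by fun_prop)

instance : IsMarkovKernel c.channel :=
  ⟨fun _ => Measure.isProbabilityMeasure_map (by fun_prop)⟩

theorem fst_channel (w : Fin (numIndices (n * R))) :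
    (c.channel w).fst = (gaussianChannel n N.a (N.PJ + N.PN1) (c.enc w)).map c.relay1 := by
  rw [← N.map_out1_noiseN, Measure.map_map c.measurable_relay1 (by fun_prop)]
  exact Measure.fst_map_prodMk (by fun_prop)

theorem snd_channel (w : Fin (numIndices (n * R))) :
    (c.channel w).snd = (gaussianChannel n N.b (N.PJ + N.PN2) (c.enc w)).map c.relay2 := by
  rw [← N.map_out2_noiseN, Measure.map_map c.measurable_relay2 (by fun_prop)]
  exact Measure.snd_map_prodMk (by fun_prop)

/-- The transmitted codeword, observed in white Gaussian noise of the same power as the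
interference. -/
def dithered : Kernel (Fin (numIndices (n * R))) (Fin n → ℝ) :=
  Kernel.ofFunOfCountable fun w => Measure.pi fun k => gaussianReal (c.enc w k) N.PJ

instance : IsMarkovKernel c.dithered :=
  ⟨fun w => inferInstanceAs
    (IsProbabilityMeasure (Measure.pi fun k => gaussianReal (c.enc w k) N.PJ))⟩

theorem lintegral_klDiv_relays_le (hPJ : N.PJ ≠ 0) (w : Fin (numIndices (n * R))) :
    ∫⁻ t, (klDiv (c.channel w).fst ((gaussianChannel n N.a (N.PJ + N.PN1)).map c.relay1 t)
        + klDiv (c.channel w).snd ((gaussianChannel n N.b (N.PJ + N.PN2)).map c.relay2 t))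
        ∂c.dithered w
      ≤ ENNReal.ofReal (n * ((N.a ^ 2 + N.b ^ 2) / 2)) := by
  have hv1 : N.PJ + N.PN1 ≠ 0 := by positivity
  have hv2 : N.PJ + N.PN2 ≠ 0 := by positivity
  calc _ ≤ ∫⁻ t, (klDiv (gaussianChannel n N.a (N.PJ + N.PN1) (c.enc w))
              (gaussianChannel n N.a (N.PJ + N.PN1) t)
            + klDiv (gaussianChannel n N.b (N.PJ + N.PN2) (c.enc w))
              (gaussianChannel n N.b (N.PJ + N.PN2) t)) ∂c.dithered w := by
        rw [fst_channel, snd_channel]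
        gcongr with t
        · rw [Kernel.map_apply _ c.measurable_relay1]
          exact klDiv_map_le _ _ c.measurable_relay1
        · rw [Kernel.map_apply _ c.measurable_relay2]
          exact klDiv_map_le _ _ c.measurable_relay2
    _ ≤ ENNReal.ofReal (n * (N.a ^ 2 / 2)) + ENNReal.ofReal (n * (N.b ^ 2 / 2)) := by
        rw [lintegral_add_left (measurable_klDiv_gaussianChannel _ hv1 _)]
        exact add_le_add (lintegral_klDiv_gaussianChannel_le _ hv1 le_self_add _)
          (lintegral_klDiv_gaussianChannel_le _ hv2 le_self_add _)
    _ = ENNReal.ofReal (n * ((N.a ^ 2 + N.b ^ 2) / 2)) := by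
        rw [← ENNReal.ofReal_add (by positivity) (by positivity)]
        congr 1
        ring

variable [Nonempty (Fin (numIndices (n * R)))]

theorem compProd_channel_real_correct :
    (uniformOn Set.univ ⊗ₘ c.channel).real {p | c.dec p.2 = p.1} = 1 - c.errorProb := by
  have := isProbabilityMeasure_uniformOn (Set.finite_univ (α := Fin (numIndices (n * R))))
    Set.univ_nonempty
  have correct_meas : MeasurableSet {p : Fin (numIndices (n * R)) ×
      Fin (numIndices (n * N.C1)) × Fin (numIndices (n * N.C2)) | c.dec p.2 = p.1} := .of_discrete
  have error_eq : (uniformOn Set.univ ⊗ₘ c.channel).real {p | c.dec p.2 = p.1}ᶜ = c.errorProb := by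
    rw [compProd_uniformOn_univ_real _ correct_meas.compl, errorProb, Fintype.card_fin]
    congr! 2 with w
    exact map_measureReal_apply (by fun_prop) .of_discrete
  rw [← error_eq, probReal_compl_eq_one_sub correct_meas, sub_sub_cancel]

theorem lintegral_klDiv_dithered_le (hPJ : N.PJ ≠ 0) :
    ∫⁻ w, klDiv (c.dithered w) (Measure.pi fun _ : Fin n => gaussianReal 0 (N.PJ + N.PX))
        ∂uniformOn Set.univ
      ≤ ENNReal.ofReal (n / 2 * Real.log (1 + N.PX / N.PJ)) := by
  have := isProbabilityMeasure_uniformOn (Set.finite_univ (α := Fin (numIndices (n * R))))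
    Set.univ_nonempty
  have power : ∫ w, ∑ k, c.enc w k ^ 2 ∂uniformOn Set.univ ≤ n * N.PX := by
    rw [integral_uniformOn_univ, Fintype.card_fin]
    exact c.power
  have power_cost : ∫⁻ w, ENNReal.ofReal ((∑ k, c.enc w k ^ 2) / (2 * (N.PJ + N.PX)))
      ∂uniformOn Set.univ ≤ ENNReal.ofReal (n * (N.PX / (N.PJ + N.PX) / 2)) := by
    rw [← ofReal_integral_eq_lintegral_ofReal .of_finite (ae_of_all _ fun w => by positivity),
      integral_div]
    refine ENNReal.ofReal_le_ofReal ?_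
    calc (∫ w, ∑ k, c.enc w k ^ 2 ∂uniformOn Set.univ) / (2 * (N.PJ + N.PX))
        ≤ n * N.PX / (2 * (N.PJ + N.PX)) := by gcongr
      _ = n * (N.PX / (N.PJ + N.PX) / 2) := by rw [mul_div_assoc, div_div, mul_comm 2]
  have h_log := div_add_le_log_one_add_div N.PX.coe_nonneg
    (NNReal.coe_pos.2 (pos_iff_ne_zero.2 hPJ))
  calc ∫⁻ w, klDiv (c.dithered w) (Measure.pi fun _ : Fin n => gaussianReal 0 (N.PJ + N.PX))
        ∂uniformOn Set.univ
      = ENNReal.ofReal (n * (Real.log (1 + N.PX / N.PJ) / 2 - N.PX / (N.PJ + N.PX) / 2))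
        + ∫⁻ w, ENNReal.ofReal ((∑ k, c.enc w k ^ 2) / (2 * (N.PJ + N.PX)))
          ∂uniformOn Set.univ := by
        refine (lintegral_congr fun w =>
          klDiv_pi_gaussianReal_add_variance (c.enc w) hPJ N.PX).trans ?_
        rw [lintegral_add_left measurable_const, lintegral_const, measure_univ, mul_one]
    _ ≤ ENNReal.ofReal (n * (Real.log (1 + N.PX / N.PJ) / 2 - N.PX / (N.PJ + N.PX) / 2))
        + ENNReal.ofReal (n * (N.PX / (N.PJ + N.PX) / 2)) := by gcongr
    _ = ENNReal.ofReal (n / 2 * Real.log (1 + N.PX / N.PJ)) := by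
        rw [← ENNReal.ofReal_add (mul_nonneg (Nat.cast_nonneg n) (by linarith)) (by positivity)]
        congr 1
        ring

theorem two_mul_channelInfo_le (hPJ : N.PJ ≠ 0) :
    2 * channelInfo (uniformOn Set.univ) c.channel
      ≤ ENNReal.ofReal (2 * (n * N.ditherBound * Real.log 2)) := by
  have := isProbabilityMeasure_uniformOn (Set.finite_univ (α := Fin (numIndices (n * R))))
    Set.univ_nonempty
  have := Kernel.IsMarkovKernel.map (gaussianChannel n N.a (N.PJ + N.PN1)) c.measurable_relay1
  have := Kernel.IsMarkovKernel.map (gaussianChannel n N.b (N.PJ + N.PN2)) c.measurable_relay2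
  have link_bits : Real.log (Nat.card (Fin (numIndices (n * N.C1)) × Fin (numIndices (n * N.C2))))
      ≤ n * ((N.C1 + N.C2) * Real.log 2) := by
    have card1_pos := numIndices_pos_iff.2 c.mul_C1_nonneg
    have card2_pos := numIndices_pos_iff.2 c.mul_C2_nonneg
    rw [Nat.card_prod, Nat.card_fin, Nat.card_fin, Nat.cast_mul, Real.log_mul
      (Nat.cast_pos.2 card1_pos).ne' (Nat.cast_pos.2 card2_pos).ne']
    linarith [log_numIndices_le c.mul_C1_nonneg, log_numIndices_le c.mul_C2_nonneg]
  have link_nonneg : 0 ≤ n * ((N.C1 + N.C2) * Real.log 2) :=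
    (Real.log_natCast_nonneg _).trans link_bits
  have dither_nonneg : 0 ≤ n / 2 * Real.log (1 + N.PX / N.PJ) := by
    have h_ratio : (1 : ℝ) ≤ 1 + N.PX / N.PJ := le_add_of_nonneg_right (by positivity)
    exact mul_nonneg (by positivity) (Real.log_nonneg h_ratio)
  refine (RelayChannel.two_mul_channelInfo_le _ c.channel c.dithered
    (Measure.pi fun _ => gaussianReal 0 (N.PJ + N.PX))
    ((gaussianChannel n N.a (N.PJ + N.PN1)).map c.relay1)
    ((gaussianChannel n N.b (N.PJ + N.PN2)).map c.relay2)).trans ?_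
  rw [lintegral_add_left .of_discrete]
  calc _ ≤ ENNReal.ofReal (n * ((N.C1 + N.C2) * Real.log 2))
        + (ENNReal.ofReal (n / 2 * Real.log (1 + N.PX / N.PJ))
          + ENNReal.ofReal (n * ((N.a ^ 2 + N.b ^ 2) / 2))) := by
        gcongr
        · exact c.lintegral_klDiv_dithered_le hPJ
        · exact (lintegral_mono (c.lintegral_klDiv_relays_le hPJ)).trans_eq
            (by rw [lintegral_const, measure_univ, mul_one])
    _ = _ := by
        rw [← ENNReal.ofReal_add dither_nonneg (by positivity),
          ← ENNReal.ofReal_add link_nonneg (by positivity), ditherBound, Real.logb]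
        congr 1
        field_simp
        ring

theorem one_sub_errorProb_mul_log_le (hPJ : N.PJ ≠ 0) :
    (1 - c.errorProb) * Real.log (numIndices (n * R)) - Real.log 2
      ≤ n * N.ditherBound * Real.log 2 := by
  have h_fano := fano c.channel (dec := c.dec) .of_discrete
  rw [c.compProd_channel_real_correct, Nat.card_fin] at h_fano
  have h_double := (mul_le_mul_right h_fano 2).trans (c.two_mul_channelInfo_le hPJ)
  rw [← ENNReal.ofReal_ofNat, ← ENNReal.ofReal_mul two_pos.le,
    ENNReal.ofReal_le_ofReal_iff (by have := c.mul_ditherBound_nonneg; positivity)] at h_double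
  exact le_of_mul_le_mul_left h_double two_pos

end Network.Code

theorem Network.Achievable.le_ditherBound {N : Network} {R : ℝ} (h : N.Achievable R)
    (hPJ : N.PJ ≠ 0) : R ≤ N.ditherBound := by
  have bound_nonneg : 0 ≤ N.ditherBound := by
    obtain ⟨n₀, codes⟩ := h 1 one_pos
    obtain ⟨c, -⟩ := codes (n₀ + 1) n₀.le_succ
    exact nonneg_of_mul_nonneg_right c.mul_ditherBound_nonneg (Nat.cast_pos.2 n₀.succ_pos)
  by_contra! gap
  have hR : 0 < R := bound_nonneg.trans_lt gap
  have gap_pos : 0 < R - N.ditherBound := sub_pos.2 gap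
  obtain ⟨θ, θ_nonneg, θ_lt_one, θ_mul⟩ :
      ∃ θ : ℝ, 0 ≤ θ ∧ θ < 1 ∧ θ * R = (R + N.ditherBound) / 2 :=
    ⟨(R + N.ditherBound) / (2 * R), by positivity, (div_lt_one (by positivity)).2 (by linarith),
      by field_simp⟩
  obtain ⟨n₀, codes⟩ := h (1 - θ) (sub_pos.2 θ_lt_one)
  obtain ⟨n, hn₀, n_large⟩ := ((eventually_ge_atTop n₀).and
    (tendsto_natCast_atTop_atTop.eventually_gt_atTop (4 / (R - N.ditherBound)))).exists
  obtain ⟨c, hc⟩ := codes n hn₀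
  rw [div_lt_iff₀ gap_pos] at n_large
  have hnR : 0 ≤ n * R := by positivity
  have : Nonempty (Fin (numIndices (n * R))) := ⟨⟨0, numIndices_pos_iff.2 hnR⟩⟩
  have message_bits : θ * (n * R - 1) - 1 ≤ n * N.ditherBound := by
    refine le_of_mul_le_mul_right ?_ (Real.log_pos one_lt_two)
    calc (θ * (n * R - 1) - 1) * Real.log 2
        = θ * ((n * R - 1) * Real.log 2) - Real.log 2 := by ring
      _ ≤ θ * Real.log (numIndices (n * R)) - Real.log 2 := by
          gcongr; exact le_log_numIndices hnR
      _ ≤ (1 - c.errorProb) * Real.log (numIndices (n * R)) - Real.log 2 := by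
          gcongr; linarith
      _ ≤ n * N.ditherBound * Real.log 2 := c.one_sub_errorProb_mul_log_le hPJ
  have : θ * (n * R) = n * ((R + N.ditherBound) / 2) := by rw [← θ_mul]; ring
  linarith

end Converse

section UniformInput

/-- The uniform law on `[-s, s]`, an input law for which the cut-set bound has its full scaling. -/
def uniformLaw (s : ℝ) : Measure ℝ := volume[|Set.Icc (-s) s]

variable {s : ℝ}

theorem isProbabilityMeasure_uniformLaw (hs : 0 < s) : IsProbabilityMeasure (uniformLaw s) := by
  refine cond_isProbabilityMeasure_of_finite ?_ measure_Icc_lt_top.ne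
  rw [Real.volume_Icc, ENNReal.ofReal_ne_zero_iff]
  linarith

theorem uniformLaw_closedBall_le (hs : 0 < s) (y r : ℝ) :
    uniformLaw s (Metric.closedBall y r) ≤ ENNReal.ofReal (r / s) := by
  rw [uniformLaw, cond_apply measurableSet_Icc, Real.volume_Icc, mul_comm, ← div_eq_mul_inv]
  calc volume (Set.Icc (-s) s ∩ Metric.closedBall y r) / ENNReal.ofReal (s - -s)
      ≤ volume (Metric.closedBall y r) / ENNReal.ofReal (s - -s) := by
        gcongr; exact Set.inter_subset_right
    _ = ENNReal.ofReal (r / s) := by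
        rw [Real.volume_closedBall, ← ENNReal.ofReal_div_of_pos (by linarith), sub_neg_eq_add,
          ← two_mul, mul_div_mul_left _ _ two_ne_zero]

theorem lintegral_sq_uniformLaw_le (hs : 0 < s) :
    ∫⁻ x, ENNReal.ofReal (x ^ 2) ∂uniformLaw s ≤ ENNReal.ofReal (s ^ 2) := by
  have := isProbabilityMeasure_uniformLaw hs
  calc ∫⁻ x, ENNReal.ofReal (x ^ 2) ∂uniformLaw s
      ≤ ∫⁻ _, ENNReal.ofReal (s ^ 2) ∂uniformLaw s := by
        refine lintegral_mono_ae ?_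
        filter_upwards [ae_cond_mem measurableSet_Icc] with x hx
        exact ENNReal.ofReal_le_ofReal (sq_le_sq' hx.1 hx.2)
    _ = ENNReal.ofReal (s ^ 2) := by rw [lintegral_const, measure_univ, mul_one]

theorem one_sub_le_measureReal_abs_le {γ : Type*} [MeasurableSpace γ] {ν : Measure γ}
    [IsProbabilityMeasure ν] {h : γ → ℝ} (hh : Measurable h) {v δ : ℝ} (hv : 0 < v) (hδ : 0 < δ)
    (h_sq : ∫⁻ z, ENNReal.ofReal (h z ^ 2) ∂ν ≤ ENNReal.ofReal v) :
    1 - δ ≤ ν.real {z | |h z| ≤ √(v / δ)} := by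
  have markov : ν {z | ENNReal.ofReal (v / δ) ≤ ENNReal.ofReal (h z ^ 2)} ≤ ENNReal.ofReal δ := by
    refine (meas_ge_le_lintegral_div (by fun_prop) (ENNReal.ofReal_pos.2 (by positivity)).ne'
      ENNReal.ofReal_ne_top).trans ?_
    refine (ENNReal.div_le_div_right h_sq _).trans_eq ?_
    rw [← ENNReal.ofReal_div_of_pos (by positivity), div_div_cancel₀ hv.ne']
  have h_compl : ν.real {z | |h z| ≤ √(v / δ)}ᶜ ≤ δ := by
    refine ENNReal.toReal_le_of_le_ofReal hδ.le ((measure_mono fun z hz => ?_).trans markov)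
    exact ENNReal.ofReal_le_ofReal (sq_abs (h z) ▸ (Real.lt_sq_of_sqrt_lt (not_le.1 hz)).le)
  rw [probReal_compl_eq_one_sub (measurableSet_le (by fun_prop) measurable_const)] at h_compl
  linarith

theorem ofReal_le_mutualInfo_uniformLaw {β γ : Type*} [MeasurableSpace β] [MeasurableSpace γ]
    {ν : Measure γ} [IsProbabilityMeasure ν] {F : ℝ → γ → β} (hF : Measurable (Function.uncurry F))
    {g : β → ℝ} (hg : Measurable g) {h : γ → ℝ} (hgF : ∀ x z, g (F x z) = x + h z) {v δ : ℝ}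
    (hs : 0 < s) (hv : 0 < v) (hδ : 0 < δ) (hδ_one : δ < 1)
    (h_sq : ∫⁻ z, ENNReal.ofReal (h z ^ 2) ∂ν ≤ ENNReal.ofReal v) :
    ENNReal.ofReal ((1 - δ) / 2 * Real.logb 2 (δ * s ^ 2 / v) - 1)
      ≤ mutualInfo (((uniformLaw s).prod ν).map fun p => (p.1, F p.1 p.2)) := by
  have := isProbabilityMeasure_uniformLaw hs
  have graph : Measurable fun p : ℝ × γ => (p.1, F p.1 p.2) := measurable_fst.prodMk hF
  have := Measure.isProbabilityMeasure_map (μ := (uniformLaw s).prod ν) graph.aemeasurable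
  have measurable_h : Measurable h := by
    have h_eq : h = fun z => g (F 0 z) := funext fun z => by rw [hgF, zero_add]
    exact h_eq ▸ hg.comp (hF.comp measurable_prodMk_left)
  have fst_joint : (((uniformLaw s).prod ν).map fun p => (p.1, F p.1 p.2)).fst = uniformLaw s := by
    rw [Measure.fst, Measure.map_map measurable_fst graph]
    exact Measure.map_fst_prod.trans (by rw [measure_univ, one_smul])
  have close : 1 - δ ≤ (((uniformLaw s).prod ν).map fun p => (p.1, F p.1 p.2)).real
      {x | dist x.1 (g x.2) ≤ √(v / δ)} := by
    have preimage : (fun p : ℝ × γ => (p.1, F p.1 p.2)) ⁻¹' {x | dist x.1 (g x.2) ≤ √(v / δ)}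
        = Set.univ ×ˢ {z | |h z| ≤ √(v / δ)} := by
      ext p
      simp only [hgF, Set.mem_preimage, Set.mem_ofPred_eq, Set.mem_prod, Set.mem_univ,
        true_and, dist_self_add_right, Real.norm_eq_abs]
    rw [map_measureReal_apply graph (measurableSet_le (by fun_prop) measurable_const), preimage,
      measureReal_prod_prod, probReal_univ, one_mul]
    exact one_sub_le_measureReal_abs_le measurable_h hv hδ h_sq
  have rate : (1 - δ) / 2 * Real.logb 2 (δ * s ^ 2 / v) - 1
      = ((1 - δ) * -Real.log (√(v / δ) / s) - Real.log 2) / Real.log 2 := by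
    have h_log : Real.log (δ * s ^ 2 / v) = 2 * -Real.log (√(v / δ) / s) := by
      rw [← Real.log_inv, inv_div, ← Real.log_rpow (by positivity), Real.rpow_two, div_pow,
        Real.sq_sqrt (by positivity)]
      congr 1
      field_simp
    rw [Real.logb, h_log]
    field_simp
  rw [rate]
  refine ofReal_le_mutualInfo_of_closedBall_le hg (sub_pos.2 hδ_one) close (by positivity)
    fun y => ?_
  rw [fst_joint]
  exact uniformLaw_closedBall_le hs y _

theorem ofReal_le_mutualInfo_uniformLaw_of_gaussian {β γ : Type*} [MeasurableSpace β]
    [MeasurableSpace γ] {ν : Measure γ} [IsProbabilityMeasure ν] {F : ℝ → γ → β}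
    (hF : Measurable (Function.uncurry F)) {g : β → ℝ} (hg : Measurable g) {h : γ → ℝ}
    (hh : Measurable h) {c : ℝ} (hc : c ≠ 0) (hgF : ∀ x z, g (F x z) = c * x + h z) {v : ℝ≥0}
    (hv : v ≠ 0) (h_law : ν.map h = gaussianReal 0 v) {δ : ℝ} (hs : 0 < s) (hδ : 0 < δ)
    (hδ_one : δ < 1) :
    ENNReal.ofReal ((1 - δ) / 2 * Real.logb 2 (δ * (c * s) ^ 2 / v) - 1)
      ≤ mutualInfo (((uniformLaw s).prod ν).map fun p => (p.1, F p.1 p.2)) := by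
  have error_sq : ∫⁻ z, ENNReal.ofReal ((h z / c) ^ 2) ∂ν = ENNReal.ofReal (v / c ^ 2) := by
    simp only [div_pow, div_eq_mul_inv _ (c ^ 2), ENNReal.ofReal_mul (sq_nonneg _),
      ENNReal.ofReal_mul v.coe_nonneg]
    rw [lintegral_mul_const _ (by fun_prop),
      ← lintegral_map (f := fun x => ENNReal.ofReal (x ^ 2)) (by fun_prop) hh, h_law]
    simpa using congrArg (· * ENNReal.ofReal (c ^ 2)⁻¹) (lintegral_sub_sq_gaussianReal 0 v 0)
  have estimator (x : ℝ) (z : γ) : g (F x z) / c = x + h z / c := by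
    rw [hgF, add_div, mul_div_cancel_left₀ x hc]
  convert ofReal_le_mutualInfo_uniformLaw hF (hg.div_const c) estimator hs
    (by positivity : 0 < (v : ℝ) / c ^ 2) hδ hδ_one error_sq.le using 5
  field_simp

end UniformInput

namespace Network

variable (N : Network) {s δ : ℝ}

theorem map_noise_sub :
    N.noise.map (fun z => z.2.1 - z.2.2) = gaussianReal 0 (N.PN1 + N.PN2) := by
  have reflected : N.noise.map (fun z => (z.2.1, -z.2.2))
      = (gaussianReal 0 N.PN1).prod (gaussianReal 0 N.PN2) := by
    rw [show (fun z : ℝ × ℝ × ℝ => (z.2.1, -z.2.2)) = Prod.map id Neg.neg ∘ Prod.snd from rfl,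
      ← Measure.map_map (by fun_prop) measurable_snd, noise, Measure.map_snd_prod, measure_univ,
      one_smul, ← Measure.map_prod_map _ _ measurable_id measurable_neg, Measure.map_id,
      gaussianReal_map_neg, neg_zero]
  rw [← map_prod_gaussianReal_const_add, ← reflected, Measure.map_map (by fun_prop) (by fun_prop)]
  congr 1
  funext z
  simp only [Function.comp_apply, zero_add, sub_eq_add_neg]

theorem ofReal_le_info1_uniformLaw (ha : N.a ≠ 0) (hv : N.PJ + N.PN1 ≠ 0) (hs : 0 < s) (hδ : 0 < δ)
    (hδ_one : δ < 1) :
    ENNReal.ofReal ((1 - δ) / 2 * Real.logb 2 (δ * (N.a * s) ^ 2 / (N.PJ + N.PN1 : ℝ≥0)) - 1)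
      ≤ N.info1 (uniformLaw s) :=
  ofReal_le_mutualInfo_uniformLaw_of_gaussian (by unfold out1; fun_prop) measurable_id
    (N.measurable_out1 0) ha (fun x z => by simp only [out1, id_eq]; ring) hv
    (by rw [map_out1_noise, mul_zero]) hs hδ hδ_one

theorem ofReal_le_info2_uniformLaw (hb : N.b ≠ 0) (hv : N.PJ + N.PN2 ≠ 0) (hs : 0 < s) (hδ : 0 < δ)
    (hδ_one : δ < 1) :
    ENNReal.ofReal ((1 - δ) / 2 * Real.logb 2 (δ * (N.b * s) ^ 2 / (N.PJ + N.PN2 : ℝ≥0)) - 1)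
      ≤ N.info2 (uniformLaw s) :=
  ofReal_le_mutualInfo_uniformLaw_of_gaussian (by unfold out2; fun_prop) measurable_id
    (N.measurable_out2 0) hb (fun x z => by simp only [out2, id_eq]; ring) hv
    (by rw [map_out2_noise, mul_zero]) hs hδ hδ_one

theorem ofReal_le_info12_uniformLaw (hab : N.a ≠ N.b) (hv : N.PN1 + N.PN2 ≠ 0) (hs : 0 < s)
    (hδ : 0 < δ) (hδ_one : δ < 1) :
    ENNReal.ofReal
        ((1 - δ) / 2 * Real.logb 2 (δ * ((N.a - N.b) * s) ^ 2 / (N.PN1 + N.PN2 : ℝ≥0)) - 1)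
      ≤ N.info12 (uniformLaw s) :=
  -- The interference cancels in `Y₁ - Y₂`.
  ofReal_le_mutualInfo_uniformLaw_of_gaussian (F := fun x z => (N.out1 x z, N.out2 x z))
    (by unfold out1 out2; fun_prop) (g := fun y => y.1 - y.2) (by fun_prop) (by fun_prop)
    (sub_ne_zero.2 hab) (fun x z => by simp only [out1, out2]; ring) hv N.map_noise_sub hs hδ hδ_one

theorem cutSetBound_le : N.cutSetBound ≤ ENNReal.ofReal N.C1 + ENNReal.ofReal N.C2 :=
  iSup_le fun _ => iSup_le fun _ => iSup_le fun _ => (min_le_left _ _).trans (min_le_left _ _)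

theorem le_cutSetBound {μ : Measure ℝ} [IsProbabilityMeasure μ]
    (h_power : ∫⁻ x, ENNReal.ofReal (x ^ 2) ∂μ ≤ N.PX) {t : ℝ≥0∞}
    (h_links : t ≤ ENNReal.ofReal N.C1 + ENNReal.ofReal N.C2)
    (h₁ : t ≤ ENNReal.ofReal N.C1 + N.info2 μ) (h₂ : t ≤ ENNReal.ofReal N.C2 + N.info1 μ)
    (h₁₂ : t ≤ N.info12 μ) : t ≤ N.cutSetBound :=
  le_iSup_of_le μ (le_iSup_of_le ‹_› (le_iSup_of_le h_power
    (le_min (le_min h_links h₁) (le_min h₂ h₁₂))))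

end Network

section LooseExample

variable {P : ℝ≥0}

theorem logb_coe_pos (hP : 1 < P) : 0 < Real.logb 2 P :=
  Real.logb_pos one_lt_two (NNReal.one_lt_coe.2 hP)

theorem one_lt_sqrt_coe (hP : 1 < P) : 1 < √(P : ℝ) :=
  Real.lt_sqrt_of_sq_lt (by rw [one_pow]; exact_mod_cast hP)

theorem tendsto_logb_coe_atTop : Tendsto (fun P : ℝ≥0 => Real.logb 2 P) atTop atTop :=
  (Real.tendsto_logb_atTop one_lt_two).comp (NNReal.tendsto_coe_atTop.2 tendsto_id)

theorem logb_sqrt_coe : Real.logb 2 √(P : ℝ) = Real.logb 2 P / 2 := by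
  rw [Real.logb, Real.log_sqrt P.coe_nonneg, Real.logb, div_right_comm]

theorem cutSetBound_looseExample_le (P : ℝ≥0) :
    (looseExample P).cutSetBound ≤ ENNReal.ofReal (Real.logb 2 P / 2) := by
  refine (looseExample P).cutSetBound_le.trans_eq ?_
  simp only [looseExample, caseC, ← two_mul]
  rw [← ENNReal.ofReal_ofNat 2, ← ENNReal.ofReal_mul zero_le_two]
  congr 1
  ring

theorem le_logb_div_sqrt_add_one {δ : ℝ} (hδ : 0 < δ) (hP : 1 < P) :
    Real.logb 2 P / 2 + Real.logb 2 (δ / 2)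
      ≤ Real.logb 2 (δ * √(P : ℝ) ^ 2 / (√(P : ℝ) + 1)) := by
  have sqrt_gt : 1 < √(P : ℝ) := one_lt_sqrt_coe hP
  rw [← logb_sqrt_coe, ← Real.logb_mul (by positivity) (by positivity)]
  refine Real.logb_le_logb_of_le one_lt_two (by positivity) ?_
  rw [le_div_iff₀ (by positivity)]
  nlinarith [mul_pos hδ (sub_pos.2 sqrt_gt)]

theorem ofReal_le_info1_looseExample {δ : ℝ} (hδ : 0 < δ) (hδ_one : δ < 1) (hP : 1 < P) :
    ENNReal.ofReal ((1 - δ) / 2 * (Real.logb 2 P / 2 + Real.logb 2 (δ / 2)) - 1)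
      ≤ (looseExample P).info1 (uniformLaw √(P : ℝ)) := by
  refine (ENNReal.ofReal_le_ofReal ?_).trans ((looseExample P).ofReal_le_info1_uniformLaw
    one_ne_zero (by simp [looseExample, caseC])
    (zero_lt_one.trans (one_lt_sqrt_coe hP)) hδ hδ_one)
  simp only [looseExample, caseC, one_mul, NNReal.coe_add, Real.coe_sqrt, NNReal.coe_one]
  nlinarith [le_logb_div_sqrt_add_one hδ hP]

theorem ofReal_le_info2_looseExample {δ : ℝ} (hδ : 0 < δ) (hδ_one : δ < 1) (hP : 1 < P) :
    ENNReal.ofReal ((1 - δ) / 2 * (Real.logb 2 P / 2 + Real.logb 2 (δ / 2)) - 1)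
      ≤ (looseExample P).info2 (uniformLaw √(P : ℝ)) := by
  refine (ENNReal.ofReal_le_ofReal ?_).trans ((looseExample P).ofReal_le_info2_uniformLaw
    (neg_ne_zero.2 one_ne_zero) (by simp [looseExample, caseC])
    (zero_lt_one.trans (one_lt_sqrt_coe hP)) hδ hδ_one)
  simp only [looseExample, caseC, neg_mul, one_mul, neg_sq, NNReal.coe_add, Real.coe_sqrt,
    NNReal.coe_one]
  nlinarith [le_logb_div_sqrt_add_one hδ hP]

theorem ofReal_le_info12_looseExample {δ : ℝ} (hδ : 0 < δ) (hδ_one : δ < 1) (hP : 0 < P) :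
    ENNReal.ofReal ((1 - δ) / 2 * (Real.logb 2 P + Real.logb 2 (δ / 2)) - 1)
      ≤ (looseExample P).info12 (uniformLaw √(P : ℝ)) := by
  refine (ENNReal.ofReal_le_ofReal ?_).trans ((looseExample P).ofReal_le_info12_uniformLaw
    (by norm_num [looseExample, caseC]) (by simp [looseExample, caseC])
    (Real.sqrt_pos.2 (NNReal.coe_pos.2 hP)) hδ hδ_one)
  have P_pos : (0 : ℝ) < P := NNReal.coe_pos.2 hP
  rw [add_comm, ← Real.logb_mul (by positivity) P_pos.ne']
  refine sub_le_sub_right (mul_le_mul_of_nonneg_left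
    (Real.logb_le_logb_of_le one_lt_two (by positivity) ?_) (by linarith)) 1
  simp only [looseExample, caseC, mul_pow, Real.sq_sqrt P_pos.le, NNReal.coe_add, NNReal.coe_one]
  nlinarith [mul_pos hδ P_pos]

theorem ofReal_le_cutSetBound_looseExample {δ : ℝ} (hδ : 0 < δ) (hδ_one : δ < 1) (hP : 1 < P) :
    ENNReal.ofReal ((1 - δ) / 2 * (Real.logb 2 P + Real.logb 2 (δ / 2)) - 1)
      ≤ (looseExample P).cutSetBound := by
  have hℓ : 0 < Real.logb 2 P := logb_coe_pos hP
  have log_δ : Real.logb 2 (δ / 2) < 0 := Real.logb_neg one_lt_two (by positivity) (by linarith)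
  have one_relay {I : ℝ≥0∞} (hI : ENNReal.ofReal
        ((1 - δ) / 2 * (Real.logb 2 P / 2 + Real.logb 2 (δ / 2)) - 1) ≤ I) :
      ENNReal.ofReal ((1 - δ) / 2 * (Real.logb 2 P + Real.logb 2 (δ / 2)) - 1)
        ≤ ENNReal.ofReal (Real.logb 2 P / 4) + I := by
    refine (ENNReal.ofReal_le_ofReal ?_).trans
      (ENNReal.ofReal_add_le.trans (add_le_add_right hI _))
    nlinarith
  have sqrt_pos : 0 < √(P : ℝ) := zero_lt_one.trans (one_lt_sqrt_coe hP)
  have := isProbabilityMeasure_uniformLaw sqrt_pos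
  refine (looseExample P).le_cutSetBound (μ := uniformLaw √(P : ℝ)) ?_
    ((ENNReal.ofReal_le_ofReal ?_).trans ENNReal.ofReal_add_le)
    (one_relay (ofReal_le_info2_looseExample hδ hδ_one hP))
    (one_relay (ofReal_le_info1_looseExample hδ hδ_one hP))
    (ofReal_le_info12_looseExample hδ hδ_one (zero_lt_one.trans hP))
  · refine (lintegral_sq_uniformLaw_le sqrt_pos).trans_eq ?_
    rw [Real.sq_sqrt P.coe_nonneg, ENNReal.ofReal_coe_nnreal]
    rfl
  · simp only [looseExample, caseC]
    nlinarith

theorem moduloBound_looseExample : (looseExample P).moduloBound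
    = (Real.logb 2 P / 2 + Real.logb 2 (1 + √(P : ℝ)) / 2) / 2
      + Real.logb 2 (8 * Real.pi * Real.exp 1) / 4 := by
  simp only [Network.moduloBound, looseExample, caseC, Real.coe_sqrt, Real.div_sqrt]
  ring

theorem Network.Achievable.le_moduloBound_looseExample {R : ℝ}
    (h : (looseExample P).Achievable R) (hP : 0 < P) : R ≤ (looseExample P).moduloBound := by
  have hPJ : (looseExample P).PJ ≠ 0 := (NNReal.sqrt_pos.2 hP).ne'
  refine (h.le_ditherBound hPJ).trans (add_le_add_right ?_ _)
  have exp_le : Real.exp 1 ≤ 8 * Real.pi := by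
    linarith [Real.exp_one_lt_d9, Real.pi_gt_three]
  have log_const : 2 ≤ Real.log (8 * Real.pi * Real.exp 1) := by
    rw [Real.le_log_iff_exp_le (by positivity), ← one_add_one_eq_two, Real.exp_add]
    gcongr
  have log_two_pos : 0 < Real.log 2 := Real.log_pos one_lt_two
  rw [Real.logb, div_div, div_le_div_iff₀ (by positivity) (by positivity)]
  simp only [looseExample, caseC]
  nlinarith

theorem tendsto_cutSetBound_looseExample : Tendsto (fun P : ℝ≥0 =>
    (looseExample P).cutSetBound.toReal / Real.logb 2 P) atTop (𝓝 (1 / 2)) := by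
  refine tendsto_order.2 ⟨fun l hl => ?_, fun u hu => ?_⟩
  · obtain ⟨m, hlm, hm⟩ := exists_between (max_lt hl one_half_pos)
    obtain ⟨hlm, hm_pos⟩ := max_lt_iff.1 hlm
    set c := Real.logb 2 ((1 - 2 * m) / 2)
    have slope : Tendsto (fun P : ℝ≥0 => m + (m * c - 1) / Real.logb 2 P) atTop (𝓝 m) := by
      simpa only [add_zero] using
        tendsto_const_nhds.add (tendsto_logb_coe_atTop.const_div_atTop (m * c - 1))
    filter_upwards [slope.eventually_const_lt hlm, eventually_gt_atTop 1] with P h_slope hP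
    have hℓ : 0 < Real.logb 2 P := logb_coe_pos hP
    have h_cut := (ENNReal.ofReal_le_iff_le_toReal
      (ne_top_of_le_ne_top ENNReal.ofReal_ne_top (cutSetBound_looseExample_le P))).1
      (ofReal_le_cutSetBound_looseExample (δ := 1 - 2 * m) (by linarith) (by linarith) hP)
    refine h_slope.trans_le ((le_div_iff₀ hℓ).2 ?_)
    rw [add_mul, div_mul_cancel₀ _ hℓ.ne']
    linarith
  · filter_upwards [eventually_gt_atTop 1] with P hP
    have hℓ : 0 < Real.logb 2 P := logb_coe_pos hP
    refine ((div_le_iff₀ hℓ).2 ?_).trans_lt hu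
    have := ENNReal.toReal_le_of_le_ofReal (by positivity) (cutSetBound_looseExample_le P)
    linarith

theorem tendsto_logb_one_add_sqrt_div_logb : Tendsto (fun P : ℝ≥0 =>
    Real.logb 2 (1 + √(P : ℝ)) / Real.logb 2 P) atTop (𝓝 (1 / 2)) := by
  have upper : Tendsto (fun P : ℝ≥0 => 1 / 2 + 1 / Real.logb 2 P) atTop (𝓝 (1 / 2)) := by
    simpa only [add_zero] using
      tendsto_const_nhds.add (tendsto_logb_coe_atTop.const_div_atTop 1)
  refine tendsto_of_tendsto_of_tendsto_of_le_of_le' tendsto_const_nhds upper ?_ ?_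
  all_goals
    filter_upwards [eventually_gt_atTop 1] with P hP
    have hℓ : 0 < Real.logb 2 P := logb_coe_pos hP
    have sqrt_gt : 1 < √(P : ℝ) := one_lt_sqrt_coe hP
  · rw [le_div_iff₀ hℓ, one_div_mul_eq_div, ← logb_sqrt_coe]
    exact Real.logb_le_logb_of_le one_lt_two (by positivity) (by linarith)
  · rw [div_le_iff₀ hℓ, add_mul, one_div_mul_cancel hℓ.ne', one_div_mul_eq_div, ← logb_sqrt_coe]
    calc Real.logb 2 (1 + √(P : ℝ)) ≤ Real.logb 2 (√(P : ℝ) * 2) :=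
          Real.logb_le_logb_of_le one_lt_two (by positivity) (by linarith)
      _ = Real.logb 2 √(P : ℝ) + 1 := by
          rw [Real.logb_mul (by positivity) two_ne_zero, Real.logb_self_eq_one one_lt_two]

theorem tendsto_moduloBound_looseExample : Tendsto (fun P : ℝ≥0 =>
    (looseExample P).moduloBound / Real.logb 2 P) atTop (𝓝 (3 / 8)) := by
  set c := Real.logb 2 (8 * Real.pi * Real.exp 1) / 4
  have limit : Tendsto (fun P : ℝ≥0 => 1 / 4 + Real.logb 2 (1 + √(P : ℝ)) / Real.logb 2 P / 4
      + c / Real.logb 2 P) atTop (𝓝 (1 / 4 + 1 / 2 / 4 + 0)) :=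
    (tendsto_const_nhds.add (tendsto_logb_one_add_sqrt_div_logb.div_const 4)).add
      (tendsto_logb_coe_atTop.const_div_atTop c)
  rw [show (1 / 4 + 1 / 2 / 4 + 0 : ℝ) = 3 / 8 by norm_num] at limit
  refine limit.congr' ?_
  filter_upwards [eventually_gt_atTop 1] with P hP
  have := (logb_coe_pos hP).ne'
  rw [moduloBound_looseExample]
  field_simp
  ring

end LooseExample

end RelayChannel

end

/-- For Case C with interference power `√P` and link capacities `¼ log₂ P`: the cut-set bound is
finite and scales as `½ log₂ P`; the modulo bound bounds every achievable rate and scales as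
`⅜ log₂ P`; so, for all large `P`, every achievable rate and the modulo bound itself lie below the
cut-set bound by at least a fixed positive multiple of `log₂ P`. -/
theorem mainTheorem7 :
    (∀ P : ℝ≥0, 1 < P → (RelayChannel.looseExample P).cutSetBound ≠ ⊤) ∧
    Tendsto (fun P : ℝ≥0 =>
        (RelayChannel.looseExample P).cutSetBound.toReal / Real.logb 2 P) atTop (𝓝 (1 / 2)) ∧
    (∀ P : ℝ≥0, 1 < P → ∀ R : ℝ, (RelayChannel.looseExample P).Achievable R →
        R ≤ (RelayChannel.looseExample P).moduloBound) ∧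
    Tendsto (fun P : ℝ≥0 =>
        (RelayChannel.looseExample P).moduloBound / Real.logb 2 P) atTop (𝓝 (3 / 8)) ∧
    (∃ ε : ℝ, 0 < ε ∧ ∀ᶠ P : ℝ≥0 in atTop,
        (RelayChannel.looseExample P).moduloBound + ε * Real.logb 2 P
            ≤ (RelayChannel.looseExample P).cutSetBound.toReal ∧
        ∀ R : ℝ, (RelayChannel.looseExample P).Achievable R →
          R + ε * Real.logb 2 P ≤ (RelayChannel.looseExample P).cutSetBound.toReal) := by
  refine ⟨fun P _ => ne_top_of_le_ne_top ENNReal.ofReal_ne_top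
      (RelayChannel.cutSetBound_looseExample_le P),
    RelayChannel.tendsto_cutSetBound_looseExample,
    fun P hP R hR => hR.le_moduloBound_looseExample (zero_lt_one.trans hP),
    RelayChannel.tendsto_moduloBound_looseExample, 1 / 16, by norm_num, ?_⟩
  filter_upwards [eventually_gt_atTop 1,
    RelayChannel.tendsto_cutSetBound_looseExample.eventually_const_lt
      (show (15 / 32 : ℝ) < 1 / 2 by norm_num),
    RelayChannel.tendsto_moduloBound_looseExample.eventually_lt_const
      (show (3 / 8 : ℝ) < 13 / 32 by norm_num)] with P hP cut_slope modulo_slope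
  have hℓ : 0 < Real.logb 2 P := RelayChannel.logb_coe_pos hP
  rw [lt_div_iff₀ hℓ] at cut_slope
  rw [div_lt_iff₀ hℓ] at modulo_slope
  have gap : (RelayChannel.looseExample P).moduloBound + 1 / 16 * Real.logb 2 P
      ≤ (RelayChannel.looseExample P).cutSetBound.toReal := by linarith
  exact ⟨gap, fun R hR => (add_le_add_left
    (hR.le_moduloBound_looseExample (zero_lt_one.trans hP)) _).trans gap⟩
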